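/- Notation. For an ordinal $\delta$ and a regular cardinal $\kappa$ let $S^{\delta}_{\kappa}=\{\alpha<\delta:\mathrm{cf}(\alpha)=\kappa\}$. A club of $\delta$ is a closed unbounded subset of $\delta$, and a set is stationary in $\delta$ if it meets every club of $\delta$. For a set $C$ of ordinals let $\mathrm{acc}(C)=\{\beta\in C:\beta=\sup(C\cap\beta)\}$ and $\mathrm{nacc}(C)=C\setminus\mathrm{acc}(C)$, and let $\mathrm{otp}(C)$ be its order type. Powers and products in $\lambda^{\omega}\cdot\kappa$ are those of ordinals. Theorem 2.1. (1) Let $\lambda,\kappa,\theta$ be regular cardinals with $\lambda>\kappa>\theta\ge\aleph_1$. Let $S^*\subseteq S^{\lambda^+}_{\theta}$ be stationary in $\lambda^+$, and suppose moreover that $$S_1=\{\delta<\lambda^+:\mathrm{cf}(\delta)=\kappa\text{ and }S^*\cap\delta\text{ is stationary in }\delta\}$$ is stationary in $\lambda^+$. Then (in ZFC) there are a set $S'\subseteq S^*$, stationary in $\lambda^+$, and a sequence $\langle E_\delta:\delta\in S'\rangle$ such that (i) for every $\delta\in S'$, $E_\delta$ is a club of $\delta$ with $\mathrm{otp}(E_\delta)<\lambda^{\omega}\cdot\kappa$;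 (ii) for every unbounded $A\subseteq S^{\lambda^+}_{\lambda}$, the set of $\delta\in S'$ with $\delta=\sup(A\cap\mathrm{nacc}(E_\delta))$ is stationary in $\lambda^+$. (2) Let $\lambda,\kappa$ be regular cardinals with $\lambda>\kappa>\aleph_0$ and $\lambda\ge 2^{\aleph_0}$. Let $S^*\subseteq S^{\lambda^+}_{\aleph_0}$ be stationary in $\lambda^+$ and such that the set $S_1$ defined as in (1) is stationary in $\lambda^+$. Then the conclusion of (1) holds. -/

import Mathlib

universe u

open Cardinal Ordinal Order Set

namespace ClubGuess

/-- The set `S^δ_κ` of all ordinals below `δ` of cofinality `κ`. -/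
def cofSet (δ : Ordinal.{u}) (κ : Cardinal.{u}) : Set Ordinal.{u} :=
  {α | α < δ ∧ α.cof = κ}

/-- `C` is a club of `δ`: a subset of `δ` which is closed and cofinal in the well-order
of all ordinals below `δ`. -/
def IsClubIn (δ : Ordinal.{u}) (C : Set Ordinal.{u}) : Prop :=
  C ⊆ Iio δ ∧ IsClub (Subtype.val ⁻¹' C : Set (Iio δ))

/-- `S ∩ δ` is stationary in `δ`, that is, `S` meets every club of `δ`. -/
def IsStationaryIn (δ : Ordinal.{u}) (S : Set Ordinal.{u}) : Prop :=
  IsStationary (Subtype.val ⁻¹' S : Set (Iio δ))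

/-- `A` is unbounded in `δ`. -/
def IsUnboundedIn (δ : Ordinal.{u}) (A : Set Ordinal.{u}) : Prop :=
  ∀ α < δ, ∃ β ∈ A, α < β ∧ β < δ

/-- `acc C`, the points `β` of `C` with `β = sup (C ∩ β)`. -/
def acc (C : Set Ordinal.{u}) : Set Ordinal.{u} :=
  {β | β ∈ C ∧ β = sSup (C ∩ Iio β)}

/-- `nacc C = C \ acc C`. -/
def nacc (C : Set Ordinal.{u}) : Set Ordinal.{u} :=
  C \ acc C

/-- The order type of a set of ordinals. A set of ordinals of universe level `u` is a subtype of a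
type of level `u + 1`, so its order type is an ordinal of that level. -/
noncomputable def otp (C : Set Ordinal.{u}) : Ordinal.{u + 1} :=
  Ordinal.type (fun a b : C => a < b)

/-- Hypothesis on `S`: it is a stationary subset of `S^{λ⁺}_θ`, and the set of `δ < λ⁺` of
cofinality `κ` such that `S ∩ δ` is stationary in `δ` is itself stationary in `λ⁺`. -/
def Reflects (lam κ θ : Cardinal.{u}) (S : Set Ordinal.{u}) : Prop :=
  S ⊆ cofSet (succ lam).ord θ ∧
  IsStationaryIn (succ lam).ord S ∧
  IsStationaryIn (succ lam).ord {δ | δ < (succ lam).ord ∧ δ.cof = κ ∧ IsStationaryIn δ S}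

/-- There are a stationary `S' ⊆ S` and clubs `E δ` of `δ` for `δ ∈ S'`, of order type less than
the ordinal `λ ^ ω * κ`, such that every unbounded `A ⊆ S^{λ⁺}_λ` satisfies
`δ = sup (A ∩ nacc (E δ))` for stationarily many `δ ∈ S'`. -/
def Guesses (lam κ : Cardinal.{u}) (S : Set Ordinal.{u}) : Prop :=
  ∃ (S' : Set Ordinal.{u}) (E : Ordinal.{u} → Set Ordinal.{u}),
    S' ⊆ S ∧ IsStationaryIn (succ lam).ord S' ∧
    (∀ δ ∈ S', IsClubIn δ (E δ) ∧
      otp (E δ) < Ordinal.lift.{u + 1} (lam.ord ^ ω * κ.ord)) ∧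
    ∀ A : Set Ordinal.{u}, A ⊆ cofSet (succ lam).ord lam → IsUnboundedIn (succ lam).ord A →
      IsStationaryIn (succ lam).ord {δ | δ ∈ S' ∧ δ = sSup (A ∩ nacc (E δ))}

end ClubGuess

/-! Fix injections `f δ` of each `δ < λ⁺` into `λ`. The sets `piece f δ i`, for `i < λ`, have size
`< λ` and increase to `δ`. If `cf δ = κ`, then for suitable `i` the piece `B` of `δ` is unbounded in
`δ` and `piece f x i = B ∩ x` for club many `x < δ` (`exists_piece_coherent`), so such `x` know `B`
below themselves.

Guessing a whole `A` needs a colouring `h` of `S` by natural numbers, all of whose colours are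
stationary in `δ`, for stationarily many `δ` (`exists_splits`). One coordinate of the ladders on `S
∩ δ` takes values stationarily often in intervals arbitrarily high in `δ`
(`Stat.exists_ladder_split`). The usable end points form a club of `κ`, and `GuessesSeq` provides an
`ω`-sequence in it from a list of length `λ`. Measured in the collapse of `B`, the resulting colour
of `x` depends only on `x` and four parameters below `λ`, which are constant for stationarily many
`δ`. The sequences come from club guessing in ZFC when `κ > ℵ₁`, and from listing all `ω`-sequences
when `κ = ℵ₁` and `2^ℵ₀ ≤ λ`.

Let `E x` be the closure of the points reached from `piece f x i` by walks of length at most `h x`.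
Every `β < δ` is reached from `B` by a finite walk. If `cf β = λ`, it is not a limit of the walk at
the first stage reaching it (`LimPt.of_walk`), hence it is a non-accumulation point of the closure.
As `cf δ` is uncountable, one stage `n` serves unboundedly many `β ∈ A ∩ δ`, and club many `x < δ`
of colour `n` then guess `A`. Each stage multiplies the order type by at most `λ + 1`, so it stays
below `λ^ω`. -/

namespace ClubGuess

/-! ### Clubs, limit points and stationary sets below an ordinal -/

/-- `γ` is a nonzero ordinal in which `X` is unbounded. -/
def LimPt (X : Set Ordinal.{u}) (γ : Ordinal.{u}) : Prop :=
  γ ≠ 0 ∧ ∀ β < γ, ∃ x ∈ X, β < x ∧ x < γ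

/-- `C` is closed and unbounded below `δ`; points of `C` above `δ` are irrelevant. -/
def Clb (δ : Ordinal.{u}) (C : Set Ordinal.{u}) : Prop :=
  LimPt C δ ∧ ∀ γ < δ, LimPt C γ → γ ∈ C

/-- `S` meets every club of `δ`, for `δ` a limit ordinal. -/
def Stat (δ : Ordinal.{u}) (S : Set Ordinal.{u}) : Prop :=
  ∀ C, Clb δ C → ∃ x ∈ S, x ∈ C ∧ x < δ

theorem LimPt.mono {X Y : Set Ordinal.{u}} {γ : Ordinal.{u}} (h : LimPt X γ)
    (hXY : ∀ x ∈ X, x < γ → x ∈ Y) : LimPt Y γ :=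
  ⟨h.1, fun β hβ => let ⟨x, hx, h1, h2⟩ := h.2 β hβ; ⟨x, hXY x hx h2, h1, h2⟩⟩

theorem LimPt.isSuccLimit {X : Set Ordinal.{u}} {γ : Ordinal.{u}} (h : LimPt X γ) :
    IsSuccLimit γ := by
  refine Ordinal.isSuccLimit_iff.2 ⟨h.1, ?_⟩
  rw [isSuccPrelimit_iff_succ_lt]
  intro a ha
  obtain ⟨x, -, h1, h2⟩ := h.2 a ha
  exact (succ_le_of_lt h1).trans_lt h2

/-- A supremum that its set does not attain is a limit point of the set. This lets all later
arguments use bare sets of ordinals instead of subsets of the subtype `Iio δ`. -/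
theorem isClub_iff {δ : Ordinal.{u}} (hδ : IsSuccLimit δ) (C : Set Ordinal.{u}) :
    IsClub (Subtype.val ⁻¹' C : Set (Iio δ)) ↔ Clb δ C := by
  constructor
  · intro h
    refine ⟨⟨hδ.ne_bot, fun β hβ => ?_⟩, fun γ hγ hl => ?_⟩
    · obtain ⟨⟨x, hx⟩, h1, h2⟩ := h.isCofinal ⟨succ β, hδ.succ_lt hβ⟩
      exact ⟨x, h1, (lt_succ β).trans_le h2, hx⟩
    · have : (⟨γ, hγ⟩ : Iio δ) ∈ (Subtype.val ⁻¹' C : Set (Iio δ)) := by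
        refine h.isLUB_mem (t := {y | y.1 ∈ C ∧ y.1 < γ}) (fun y hy => hy.1) ?_ ⟨?_, ?_⟩
        · obtain ⟨x, hx, -, h2⟩ := hl.2 0 (pos_iff_ne_zero.2 hl.1)
          exact ⟨⟨x, h2.trans hγ⟩, hx, h2⟩
        · exact fun y hy => hy.2.le
        · intro y hy
          by_contra hlt
          obtain ⟨x, hx, h1, h2⟩ := hl.2 y.1 (not_le.1 hlt)
          exact not_lt_of_ge (hy (a := ⟨x, h2.trans hγ⟩) ⟨hx, h2⟩) h1
      exact this
  · rintro ⟨h1, h2⟩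
    refine ⟨fun d hd hne _ a ha => ?_, fun a => ?_⟩
    · by_cases had : a ∈ d
      · exact hd had
      refine h2 a.1 a.2 ⟨?_, fun β hβ => ?_⟩
      · rintro h0
        obtain ⟨y, hy⟩ := hne
        have : y ≤ a := ha.1 hy
        have h3 : y.1 ≤ 0 := h0 ▸ this
        have h4 : y = a := Subtype.ext ((le_antisymm h3 bot_le).trans h0.symm)
        exact had (h4 ▸ hy)
      · have : ¬ (⟨β, hβ.trans a.2⟩ : Iio δ) ∈ upperBounds d :=
          fun hu => not_lt_of_ge (ha.2 hu) hβ
        simp only [upperBounds, mem_ofPred_eq, not_forall, not_le] at this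
        obtain ⟨y, hy, hlt⟩ := this
        exact ⟨y.1, hd hy, hlt, lt_of_le_of_ne (ha.1 hy) fun e => had ((Subtype.ext e : y = a) ▸ hy)⟩
    · obtain ⟨x, hx, hl, hlt⟩ := h1.2 a.1 a.2
      exact ⟨⟨x, hlt⟩, hx, hl.le⟩

theorem isStationaryIn_iff {δ : Ordinal.{u}} (hδ : IsSuccLimit δ) (S : Set Ordinal.{u}) :
    IsStationaryIn δ S ↔ Stat δ S := by
  constructor
  · intro h C hC
    obtain ⟨x, hx, hx'⟩ := h ((isClub_iff hδ C).2 hC)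
    exact ⟨x.1, hx, hx', x.2⟩
  · intro h t ht
    have e : (Subtype.val ⁻¹' (Subtype.val '' t) : Set (Iio δ)) = t :=
      preimage_image_eq t Subtype.val_injective
    obtain ⟨x, hx, hx', hlt⟩ := h (Subtype.val '' t) ((isClub_iff hδ _).1 (e.symm ▸ ht))
    obtain ⟨y, hy, rfl⟩ := hx'
    exact ⟨y, hx, hy⟩

theorem isSuccLimit_of_aleph0_le_cof {δ : Ordinal.{u}} (h : ℵ₀ ≤ δ.cof) : IsSuccLimit δ := by
  rwa [aleph0_le_cof_iff, one_lt_cof_iff] at h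

theorem cof_Iio_eq (δ : Ordinal.{u}) : Order.cof (Iio δ) = Cardinal.lift.{u + 1} δ.cof := by
  rw [cof_Iio, lift_cof]

theorem cof_Iio_ne {δ : Ordinal.{u}} (h : ℵ₀ < δ.cof) : Order.cof (Iio δ) ≠ ℵ₀ := by
  rw [cof_Iio_eq]
  intro e
  rw [← Cardinal.lift_aleph0.{u + 1, u}, Cardinal.lift_inj] at e
  exact h.ne' e

theorem Clb.inter {δ : Ordinal.{u}} (hδ : ℵ₀ < δ.cof) {C D : Set Ordinal.{u}} (hC : Clb δ C)
    (hD : Clb δ D) : Clb δ (C ∩ D) := by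
  have hl := isSuccLimit_of_aleph0_le_cof hδ.le
  rw [← isClub_iff hl] at *
  exact hC.inter (cof_Iio_ne hδ) hD

theorem Clb.iInter {δ : Ordinal.{u}} (hδ : ℵ₀ < δ.cof) {I : Set Ordinal.{u}}
    (hI : #I < Cardinal.lift.{u + 1} δ.cof) {C : Ordinal.{u} → Set Ordinal.{u}}
    (hC : ∀ i ∈ I, Clb δ (C i)) : Clb δ {x | ∀ i ∈ I, x ∈ C i} := by
  have hl := isSuccLimit_of_aleph0_le_cof hδ.le
  rw [← isClub_iff hl]
  have := IsClub.iInter (f := fun i : I => (Subtype.val ⁻¹' C i : Set (Iio δ))) (cof_Iio_ne hδ)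
    (by rw [cof_Iio_eq]; simpa using hI) (fun i => (isClub_iff hl _).2 (hC i i.2))
  convert this using 1
  ext x
  simp

theorem Stat.inter {δ : Ordinal.{u}} (hδ : ℵ₀ < δ.cof) {S C : Set Ordinal.{u}} (hS : Stat δ S)
    (hC : Clb δ C) : Stat δ (S ∩ C) := fun _ hD =>
  let ⟨x, hx, h1, h2⟩ := hS _ (hC.inter hδ hD)
  ⟨x, ⟨hx, h1.1⟩, h1.2, h2⟩

theorem Stat.mono {δ : Ordinal.{u}} {S T : Set Ordinal.{u}} (hS : Stat δ S)
    (h : ∀ x ∈ S, x < δ → x ∈ T) : Stat δ T := fun D hD =>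
  let ⟨x, hx, h1, h2⟩ := hS D hD
  ⟨x, h x hx h2, h1, h2⟩

theorem mk_Iio_lt {o : Ordinal.{u}} {c : Cardinal.{u}} (h : o < c.ord) :
    #(Iio o) < Cardinal.lift.{u + 1} c := by
  rw [Cardinal.mk_Iio_ordinal, Cardinal.lift_lt]
  exact lt_ord.1 h

theorem exists_lt_forall_le {δ : Ordinal.{u}} {I : Set Ordinal.{u}}
    (hI : #I < Cardinal.lift.{u + 1} δ.cof) {g : Ordinal.{u} → Ordinal.{u}}
    (hg : ∀ i ∈ I, g i < δ) : ∃ γ < δ, ∀ i ∈ I, g i ≤ γ := by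
  have hlt : #(g '' I) < (Ordinal.lift.{u + 1} δ).cof := by
    rw [← lift_cof]; exact mk_image_le.trans_lt hI
  refine ⟨sSup (g '' I), sSup_lt_of_lt_cof hlt (by simpa using hg), fun i hi => ?_⟩
  exact le_csSup ⟨δ, by rintro _ ⟨j, hj, rfl⟩; exact (hg j hj).le⟩ (mem_image_of_mem g hi)

theorem exists_lt_forall_nat_le {δ : Ordinal.{u}} (hδ : ℵ₀ < δ.cof) {g : ℕ → Ordinal.{u}}
    (hg : ∀ i, g i < δ) : ∃ γ < δ, ∀ i, g i ≤ γ := by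
  have : ⨆ i, g i < δ := lift_iSup_lt_of_lt_cof (by simpa using hδ) hg
  exact ⟨_, this, fun i => Ordinal.le_iSup g i⟩

/-- A small union of sets is stationary only if one of the sets is. -/
theorem Stat.exists_of_forall {δ : Ordinal.{u}} (hδ : ℵ₀ < δ.cof) {I : Set Ordinal.{u}}
    (hI : #I < Cardinal.lift.{u + 1} δ.cof) {S : Set Ordinal.{u}} (hS : Stat δ S)
    {Q : Ordinal.{u} → Ordinal.{u} → Prop} (hQ : ∀ x ∈ S, x < δ → ∃ i ∈ I, Q i x) :
    ∃ i ∈ I, Stat δ {x ∈ S | Q i x} := by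
  by_contra! hcon
  have : ∀ i, ∃ C, i ∈ I → Clb δ C ∧ ∀ x ∈ S, Q i x → x ∈ C → δ ≤ x := by
    intro i
    by_cases hi : i ∈ I
    · have := hcon i hi
      simp only [Stat, not_forall, not_exists, not_and, not_lt] at this
      obtain ⟨C, hC, h⟩ := this
      exact ⟨C, fun _ => ⟨hC, fun x hx hq hc => h x ⟨hx, hq⟩ hc⟩⟩
    · exact ⟨∅, fun h => absurd h hi⟩
  choose C hC using this
  obtain ⟨x, hx, hxC, hlt⟩ := hS _ (Clb.iInter hδ hI fun i hi => (hC i hi).1)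
  obtain ⟨i, hi, hq⟩ := hQ x hx hlt
  exact not_lt_of_ge ((hC i hi).2 x hx hq (hxC i hi)) hlt

/-- The points closed under a relation that is antitone in its first argument form a club. -/
theorem clb_setOf_closed {δ : Ordinal.{u}} (hδ : ℵ₀ < δ.cof) {R : Ordinal.{u} → Ordinal.{u} → Prop}
    (hR : ∀ x' x y, x' ≤ x → x < δ → R x y → R x' y) (hex : ∀ x < δ, ∃ y < δ, x < y ∧ R x y) :
    Clb δ {γ | γ ≠ 0 ∧ ∀ x < γ, ∃ y < γ, x < y ∧ R x y} := by
  have hl := isSuccLimit_of_aleph0_le_cof hδ.le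
  refine ⟨⟨hl.ne_bot, fun β hβ => ?_⟩, fun γ _ hγ => ⟨hγ.1, fun x hx => ?_⟩⟩
  · choose! f hf1 hf2 hf3 using hex
    let g : ℕ → Ordinal.{u} := fun n => f^[n] (f β)
    have hgs : ∀ n, g (n + 1) = f (g n) := fun n => Function.iterate_succ_apply' f n _
    have hg : ∀ n, g n < δ := by
      intro n
      induction n with
      | zero => exact hf1 β hβ
      | succ n ih => rw [hgs]; exact hf1 _ ih
    have hlt : ⨆ n, g n < δ := lift_iSup_lt_of_lt_cof (by simpa using hδ) hg
    have hβg : β < ⨆ n, g n := (hf2 β hβ).trans_le (Ordinal.le_iSup g 0)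
    refine ⟨⨆ n, g n, ⟨(bot_le.trans_lt hβg).ne', fun x hx => ?_⟩, hβg, hlt⟩
    obtain ⟨n, hn⟩ := Ordinal.lt_iSup_iff.1 hx
    refine ⟨g (n + 1), ?_, ?_, ?_⟩
    · refine lt_of_lt_of_le ?_ (Ordinal.le_iSup g (n + 2))
      rw [hgs (n + 1)]; exact hf2 _ (hg _)
    · rw [hgs]; exact hn.trans (hf2 _ (hg _))
    -- Antitonicity passes the relation from the iterate `g n` down to an arbitrary `x` below it.
    · rw [hgs]; exact hR _ _ _ hn.le (hg n) (hf3 _ (hg n))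
  · obtain ⟨c, hc, hxc, hcγ⟩ := hγ.2 x hx
    obtain ⟨y, hy, h1, h2⟩ := hc.2 x hxc
    exact ⟨y, hy.trans hcγ, h1, h2⟩

theorem clb_limPt {δ : Ordinal.{u}} (hδ : ℵ₀ < δ.cof) {X : Set Ordinal.{u}} (hX : LimPt X δ) :
    Clb δ {γ | LimPt X γ} := by
  have := clb_setOf_closed hδ (R := fun x y => y ∈ X) (fun _ _ _ _ _ h => h)
    (fun x hx => let ⟨y, hy, h1, h2⟩ := hX.2 x hx; ⟨y, h2, h1, hy⟩)
  convert this using 1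
  ext γ
  simp only [LimPt, mem_ofPred_eq]
  constructor
  · exact fun h => ⟨h.1, fun x hx => let ⟨y, hy, h1, h2⟩ := h.2 x hx; ⟨y, h2, h1, hy⟩⟩
  · exact fun h => ⟨h.1, fun x hx => let ⟨y, h2, h1, hy⟩ := h.2 x hx; ⟨y, hy, h1, h2⟩⟩

theorem Clb.of_limPt {δ γ : Ordinal.{u}} {C : Set Ordinal.{u}} (hC : Clb δ C) (hγ : γ < δ)
    (h : LimPt C γ) : Clb γ C :=
  ⟨h, fun _ hx hl => hC.2 _ (hx.trans hγ) hl⟩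

/-- A closed set contains the suprema of its nonempty subsets. -/
theorem Clb.sSup_mem {δ : Ordinal.{u}} {C D : Set Ordinal.{u}} (hC : Clb δ C) (hD : D ⊆ C)
    (hne : D.Nonempty) {y : Ordinal.{u}} (hy : y < δ) (hb : ∀ x ∈ D, x ≤ y) : sSup D ∈ C := by
  by_cases hm : sSup D ∈ D
  · exact hD hm
  have hbd : BddAbove D := ⟨y, hb⟩
  refine hC.2 _ ((csSup_le hne hb).trans_lt hy) ⟨?_, fun β hβ => ?_⟩
  · intro h0
    obtain ⟨x, hx⟩ := hne
    have h1 := le_csSup hbd hx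
    rw [h0] at h1
    have : x = sSup D := by rw [h0]; exact le_antisymm h1 bot_le
    exact hm (this ▸ hx)
  · obtain ⟨x, hx, h⟩ := (lt_csSup_iff hbd hne).1 hβ
    exact ⟨x, hD hx, h, lt_of_le_of_ne (le_csSup hbd hx) fun e => hm (e ▸ hx)⟩

/-! ### Order types through rank functions, and cofinal maps -/

/-- `X` carries a strictly increasing function into the ordinals below `μ`. -/
def Ranked (X : Set Ordinal.{u}) (μ : Ordinal.{u}) : Prop :=
  ∃ r : Ordinal.{u} → Ordinal.{u}, (∀ x ∈ X, r x < μ) ∧ StrictMonoOn r X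

theorem Ranked.mono {X Y : Set Ordinal.{u}} {μ ν : Ordinal.{u}} (h : Ranked X μ) (hY : Y ⊆ X)
    (hμ : μ ≤ ν) : Ranked Y ν :=
  let ⟨r, h1, h2⟩ := h
  ⟨r, fun x hx => (h1 x (hY hx)).trans_le hμ, h2.mono hY⟩

/-- Rank functions keep all estimates in universe `u`; the lift to the universe of `otp` happens
only here. -/
theorem Ranked.otp_le {X : Set Ordinal.{u}} {μ : Ordinal.{u}} (h : Ranked X μ) :
    otp X ≤ Ordinal.lift.{u + 1} μ := by
  obtain ⟨r, h1, h2⟩ := h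
  have : Ordinal.lift.{u + 1} μ = Ordinal.type (fun a b : Iio μ => a < b) := by
    have := Ordinal.typein_ordinal μ
    rw [← this]
    rfl
  rw [this]
  refine Ordinal.type_le_iff'.2 ⟨RelEmbedding.ofMonotone (fun x => ⟨r x.1, h1 x.1 x.2⟩) ?_⟩
  exact fun a b hab => h2 a.2 b.2 hab

theorem Ranked.mk_le {X : Set Ordinal.{u}} {μ : Ordinal.{u}} (h : Ranked X μ) :
    #X ≤ Cardinal.lift.{u + 1} μ.card := by
  obtain ⟨r, h1, h2⟩ := h
  rw [← Cardinal.mk_Iio_ordinal]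
  refine Cardinal.mk_le_of_injective (f := fun x : X => (⟨r x.1, h1 x.1 x.2⟩ : Iio μ)) ?_
  intro a b hab
  exact Subtype.ext (h2.injOn a.2 b.2 (congrArg Subtype.val hab))

theorem exists_cofinal_ranked (δ : Ordinal.{u}) :
    ∃ s ⊆ Iio δ, (∀ β < δ, ∃ x ∈ s, β ≤ x) ∧ Ranked s δ.cof.ord := by
  obtain ⟨s, hs, ht⟩ := exists_ord_cof_eq (α := δ.ToType)
  rw [cof_toType] at ht
  obtain ⟨m, hm, hsurj⟩ : ∃ m : ∀ x, x < δ → δ.ToType,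
      (∀ x y hx hy, m x hx < m y hy ↔ x < y) ∧ ∀ z, ∃ x hx, m x hx = z :=
    ⟨fun x hx => ToType.mk ⟨x, mem_Iio.2 hx⟩,
      fun x y hx hy => (OrderIso.lt_iff_lt ToType.mk).trans Iff.rfl,
      fun z => ⟨(ToType.mk.symm z).1, (ToType.mk.symm z).2, ToType.mk.apply_symm_apply z⟩⟩
  classical
  refine ⟨{x | ∃ h : x < δ, m x h ∈ s}, fun x hx => hx.1, fun β hβ => ?_,
    fun x => if h : ∃ h : x < δ, m x h ∈ s then
      typein (α := s) (· < ·) ⟨m x h.1, h.2⟩ else 0, ?_, ?_⟩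
  · obtain ⟨y, hy, hle⟩ := hs (m β hβ)
    obtain ⟨z, hz, rfl⟩ := hsurj y
    exact ⟨z, ⟨hz, hy⟩, not_lt.1 fun h => hle.not_gt ((hm _ _ _ _).2 h)⟩
  · intro x hx
    have hx' : ∃ h : x < δ, m x h ∈ s := hx
    simp only [dif_pos hx', ← ht]
    exact typein_lt_type _ _
  · intro x hx y hy hxy
    have hx' : ∃ h : x < δ, m x h ∈ s := hx
    have hy' : ∃ h : y < δ, m y h ∈ s := hy
    simp only [dif_pos hx', dif_pos hy']
    rw [typein_lt_typein]
    exact (hm _ _ _ _).2 hxy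

/-- A cofinal monotone map from the cofinality of `δ` into `δ`. -/
theorem exists_monotone_cofinal (δ : Ordinal.{u}) :
    ∃ q : Ordinal.{u} → Ordinal.{u}, Monotone q ∧ (∀ x < δ.cof.ord, q x < δ) ∧
      (δ.cof ≠ 1 → ∀ β < δ, ∃ x < δ.cof.ord, β ≤ q x) := by
  obtain ⟨s, hs, hcof, r, hr, hmono⟩ := exists_cofinal_ranked δ
  refine ⟨fun x => sSup {y ∈ s | r y < x}, fun x x' hx => ?_, fun x hx => ?_, fun h1 β hβ => ?_⟩
  · rcases ({y ∈ s | r y < x}).eq_empty_or_nonempty with he | hne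
    · simp only [he, csSup_empty]; exact bot_le
    · exact csSup_le_csSup ⟨δ, fun y hy => (hs hy.1).le⟩ hne fun y hy => ⟨hy.1, hy.2.trans_le hx⟩
  · refine sSup_lt_of_lt_cof ?_ fun y hy => hs hy.1
    rw [← lift_cof]
    refine (Ranked.mk_le ⟨r, fun y hy => hy.2, hmono.mono fun y hy => hy.1⟩).trans_lt ?_
    rw [Cardinal.lift_lt]
    exact lt_ord.1 hx
  · obtain ⟨x, hx, hle⟩ := hcof β hβ
    -- The successor compensates for the strict inequality `r y < x` in the supremum. It stays below
    -- the cofinality because the latter is infinite once successor `δ` are excluded.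
    refine ⟨succ (r x), ?_, hle.trans (le_csSup ⟨δ, fun y hy => (hs hy.1).le⟩ ⟨hx, lt_succ _⟩)⟩
    have : IsSuccLimit δ := by
      rw [← one_lt_cof_iff]
      refine lt_of_le_of_ne ?_ h1.symm
      rw [Cardinal.one_le_iff_ne_zero]
      exact fun h0 => (cof_eq_zero.1 h0 ▸ hβ).not_ge bot_le
    exact (Cardinal.isSuccLimit_ord (isRegular_cof this).aleph0_le).succ_lt (hr x hx)

/-- In the union of fewer than `cf δ` sets that is unbounded in `δ`, one set is unbounded. -/
theorem LimPt.exists_nat {δ : Ordinal.{u}} (hδ : ℵ₀ < δ.cof) {X : Set Ordinal.{u}} (hX : LimPt X δ)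
    {Q : ℕ → Ordinal.{u} → Prop} (hQ : ∀ x ∈ X, x < δ → ∃ n, Q n x) :
    ∃ n, LimPt {x ∈ X | Q n x} δ := by
  by_contra! hcon
  have : ∀ n, ∃ β < δ, ∀ x ∈ X, Q n x → β < x → δ ≤ x := by
    intro n
    by_contra! h
    exact hcon n ⟨hX.1, fun β hβ => let ⟨x, h1, h2, h3, h4⟩ := h β hβ; ⟨x, ⟨h1, h2⟩, h3, h4⟩⟩
  choose g hg hg' using this
  obtain ⟨γ, hγ, hle⟩ := exists_lt_forall_nat_le hδ hg
  obtain ⟨x, hx, h1, h2⟩ := hX.2 γ hγ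
  obtain ⟨n, hn⟩ := hQ x hx h2
  exact (hg' n x hx hn ((hle n).trans_lt h1)).not_gt h2

/-- Increasing sequences in a set unbounded in `δ`. -/
theorem LimPt.exists_strictMono {δ : Ordinal.{u}} {X : Set Ordinal.{u}} (hX : LimPt X δ) :
    ∃ f : ℕ → Ordinal.{u}, StrictMono f ∧ ∀ n, f n ∈ X ∧ f n < δ := by
  have h : ∀ β < δ, ∃ x ∈ X, β < x ∧ x < δ := hX.2
  choose! f hf1 hf2 hf3 using h
  have hlt : ∀ n, f^[n] 0 < δ := by
    intro n
    induction n with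
    | zero => exact pos_iff_ne_zero.2 hX.1
    | succ n ih => rw [Function.iterate_succ_apply']; exact hf3 _ ih
  refine ⟨fun n => f^[n + 1] 0, strictMono_nat_of_lt_succ fun n => ?_, fun n => ⟨?_, hlt _⟩⟩
  · have := hf2 _ (hlt (n + 1)); rwa [← Function.iterate_succ_apply' f] at this
  · simp only [Function.iterate_succ_apply']; exact hf1 _ (hlt _)

theorem not_limPt_of_mk_lt {Y : Set Ordinal.{u}} {b : Ordinal.{u}}
    (h : #Y < Cardinal.lift.{u + 1} b.cof) : ¬ LimPt Y b := by
  intro hl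
  obtain ⟨γ, hγ, hle⟩ := exists_lt_forall_le (I := Y ∩ Iio b) (g := id)
    ((mk_le_mk_of_subset inter_subset_left).trans_lt h) fun x hx => hx.2
  obtain ⟨x, hx, h1, h2⟩ := hl.2 γ hγ
  exact (hle x ⟨hx, h2⟩).not_gt h1

/-- Order types of sets fibred over a ranked set. -/
theorem Ranked.of_fibers {X Y : Set Ordinal.{u}} {μ L : Ordinal.{u}} (hX : Ranked X μ)
    {f g : Ordinal.{u} → Ordinal.{u}} (hf : MapsTo f Y X) (hfm : MonotoneOn f Y)
    (hg : ∀ y ∈ Y, g y < L) (hfg : ∀ y ∈ Y, ∀ z ∈ Y, y < z → f y = f z → g y < g z) :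
    Ranked Y (L * μ) := by
  obtain ⟨r, h1, h2⟩ := hX
  have key : ∀ y ∈ Y, ∀ ν, r (f y) < ν → L * r (f y) + g y < L * ν := fun y hy ν hν => by
    calc L * r (f y) + g y < L * r (f y) + L := by gcongr; exact hg y hy
      _ = L * succ (r (f y)) := (Ordinal.mul_succ _ _).symm
      _ ≤ L * ν := by gcongr; exact succ_le_of_lt hν
  refine ⟨fun y => L * r (f y) + g y, fun y hy => key y hy μ (h1 _ (hf hy)), fun y hy z hz hyz => ?_⟩
  rcases (hfm hy hz hyz.le).lt_or_eq with hlt | heq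
  · exact (key y hy _ (h2 (hf hy) (hf hz) hlt)).trans_le le_self_add
  · simp only [heq]
    gcongr
    exact hfg y hy z hz hyz heq

/-! ### Closures of sets of ordinals -/

/-- The least element of `X` that is at least `b`. -/
noncomputable def next (X : Set Ordinal.{u}) (b : Ordinal.{u}) : Ordinal.{u} :=
  sInf {x ∈ X | b ≤ x}

theorem next_spec {X : Set Ordinal.{u}} {b x : Ordinal.{u}} (hx : x ∈ X) (hb : b ≤ x) :
    next X b ∈ X ∧ b ≤ next X b :=
  csInf_mem (s := {x ∈ X | b ≤ x}) ⟨x, hx, hb⟩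

theorem next_le {X : Set Ordinal.{u}} {b x : Ordinal.{u}} (hx : x ∈ X) (hb : b ≤ x) :
    next X b ≤ x :=
  csInf_le' (s := {x ∈ X | b ≤ x}) ⟨hx, hb⟩

theorem next_eq {X : Set Ordinal.{u}} {b a : Ordinal.{u}} (ha : a ∈ X) (hb : b ≤ a)
    (h : ∀ x ∈ X, b ≤ x → a ≤ x) : next X b = a :=
  (next_le ha hb).antisymm (h _ (next_spec ha hb).1 (next_spec ha hb).2)

/-- The closure of `X` below `δ`. -/
def cl (δ : Ordinal.{u}) (X : Set Ordinal.{u}) : Set Ordinal.{u} :=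
  {b | b < δ ∧ (b ∈ X ∨ LimPt X b)}

theorem LimPt.of_cl {δ γ : Ordinal.{u}} {X : Set Ordinal.{u}} (h : LimPt (cl δ X) γ) :
    LimPt X γ := by
  refine ⟨h.1, fun β hβ => ?_⟩
  obtain ⟨x, ⟨-, hx | hx⟩, h1, h2⟩ := h.2 β hβ
  · exact ⟨x, hx, h1, h2⟩
  · obtain ⟨y, hy, h3, h4⟩ := hx.2 β h1
    exact ⟨y, hy, h3, h4.trans h2⟩

theorem clb_cl {δ : Ordinal.{u}} {X : Set Ordinal.{u}} (h : LimPt X δ) : Clb δ (cl δ X) :=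
  ⟨h.mono fun _ hx hlt => ⟨hlt, .inl hx⟩, fun _ hγ hl => ⟨hγ, .inr hl.of_cl⟩⟩

theorem isClubIn_cl {δ : Ordinal.{u}} {X : Set Ordinal.{u}} (h : LimPt X δ) :
    IsClubIn δ (cl δ X) :=
  ⟨fun _ hx => hx.1, (isClub_iff h.isSuccLimit _).2 (clb_cl h)⟩

theorem mem_nacc_cl {δ x : Ordinal.{u}} {X : Set Ordinal.{u}} (hx : x ∈ X) (hδ : x < δ)
    (h0 : x ≠ 0) (hl : ¬ LimPt X x) : x ∈ nacc (cl δ X) := by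
  refine ⟨⟨hδ, .inl hx⟩, fun hacc => hl ?_⟩
  refine LimPt.of_cl (δ := δ) ⟨h0, fun β hβ => ?_⟩
  have hlt : β < sSup (cl δ X ∩ Iio x) := hacc.2 ▸ hβ
  have hne : (cl δ X ∩ Iio x).Nonempty := by
    by_contra he
    rw [not_nonempty_iff_eq_empty.1 he, csSup_empty] at hlt
    exact hlt.not_ge bot_le
  obtain ⟨y, hy, h⟩ := (lt_csSup_iff ⟨x, fun y hy => hy.2.le⟩ hne).1 hlt
  exact ⟨y, hy.1, h, hy.2⟩

/-- Over `a ∈ X`, the fibre of `next X` in the closure holds at most `a` itself and one limit point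
outside `X` below it; this is the factor 2. -/
theorem Ranked.cl {δ μ : Ordinal.{u}} {X : Set Ordinal.{u}} (hX : Ranked X μ) (h : LimPt X δ) :
    Ranked (cl δ X) (2 * μ) := by
  classical
  have hex : ∀ b < δ, ∃ x ∈ X, b ≤ x := fun b hb =>
    let ⟨x, hx, h1, _⟩ := h.2 b hb; ⟨x, hx, h1.le⟩
  refine hX.of_fibers (f := next X) (g := fun b => if b ∈ X then 1 else 0) (fun b hb => ?_)
    (fun b hb c hc hbc => ?_) (fun b _ => ?_) (fun b hb c hc hbc he => ?_)
  · obtain ⟨x, hx, h⟩ := hex b hb.1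
    exact (next_spec hx h).1
  · obtain ⟨x, hx, h⟩ := hex c hc.1
    exact next_le (next_spec hx h).1 (hbc.trans (next_spec hx h).2)
  · split_ifs
    · exact one_lt_two
    · exact zero_lt_two
  · obtain ⟨x, hx, h⟩ := hex c hc.1
    have hcn := (next_spec hx h).2
    have hb' : b ∉ X := fun hbX => by
      have := next_le hbX le_rfl
      rw [he] at this
      exact (hbc.trans_le (hcn.trans this)).false
    have hc' : c ∈ X := by
      refine hc.2.resolve_right fun hl => ?_
      obtain ⟨y, hy, h1, h2⟩ := hl.2 b hbc
      have := next_le hy h1.le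
      rw [he] at this
      exact (h2.trans_le (hcn.trans this)).false
    simp [hb', hc']

/-! ### Walks along a system of cofinal sets -/

/-- Add to `X`, for each `a ∈ X`, the part of `e a` in the gap of `X` directly below `a`. -/
def step (e : Ordinal.{u} → Set Ordinal.{u}) (X : Set Ordinal.{u}) : Set Ordinal.{u} :=
  X ∪ {b | ∃ a ∈ X, b ∈ e a ∧ b < a ∧ ∀ x ∈ X, b ≤ x → a ≤ x}

/-- The points reached from `X` by walks of length at most `n` along `e`. -/
def walk (e : Ordinal.{u} → Set Ordinal.{u}) (X : Set Ordinal.{u}) : ℕ → Set Ordinal.{u}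
  | 0 => X
  | n + 1 => step e (walk e X n)

section Walk

variable {e : Ordinal.{u} → Set Ordinal.{u}} {X : Set Ordinal.{u}}

theorem subset_walk (n : ℕ) : X ⊆ walk e X n := by
  induction n with
  | zero => exact subset_rfl
  | succ n ih => exact ih.trans subset_union_left

/-- For `b < δ`, a point of `X` lies between `b` and `δ`, so the `a` whose gap contains `b` is below
`δ`. By this locality a walk computed at `x` agrees with the walk computed at a larger `δ`. -/
theorem step_inter_Iio {δ : Ordinal.{u}} (h : LimPt X δ) :
    step e X ∩ Iio δ = step e (X ∩ Iio δ) := by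
  ext b
  constructor
  · rintro ⟨hb | ⟨a, ha, h1, h2, h3⟩, hlt⟩
    · exact .inl ⟨hb, hlt⟩
    · obtain ⟨x, hx, h4, h5⟩ := h.2 b hlt
      exact .inr ⟨a, ⟨ha, (h3 x hx h4.le).trans_lt h5⟩, h1, h2, fun y hy => h3 y hy.1⟩
  · rintro (hb | ⟨a, ha, h1, h2, h3⟩)
    · exact ⟨.inl hb.1, hb.2⟩
    · refine ⟨.inr ⟨a, ha.1, h1, h2, fun x hx hbx => ?_⟩, h2.trans ha.2⟩
      by_cases hxδ : x < δ
      · exact h3 x ⟨hx, hxδ⟩ hbx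
      · exact (le_of_lt ha.2).trans (not_lt.1 hxδ)

theorem walk_inter_Iio {δ : Ordinal.{u}} (h : LimPt X δ) (n : ℕ) :
    walk e X n ∩ Iio δ = walk e (X ∩ Iio δ) n := by
  induction n with
  | zero => rfl
  | succ n ih =>
    rw [walk, walk, ← ih]
    exact step_inter_Iio (h.mono fun x hx _ => subset_walk n hx)

theorem walk_subset_Iio {δ : Ordinal.{u}} (h : X ⊆ Iio δ) (n : ℕ) : walk e X n ⊆ Iio δ := by
  induction n with
  | zero => exact h
  | succ n ih =>
    rintro b (hb | ⟨a, ha, -, h2, -⟩)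
    · exact ih hb
    · exact h2.trans (ih ha)

/-- Every ordinal below a limit of `X` is reached by a walk. -/
theorem exists_mem_walk {δ Λ β : Ordinal.{u}} (he : ∀ a < Λ, ∀ b < a, ∃ c ∈ e a, b ≤ c ∧ c < a)
    (hXΛ : X ⊆ Iio Λ) (hX : LimPt X δ) (hβ : β < δ) : ∃ n, β ∈ walk e X n := by
  -- Here `a` is the least point at or above `β` at stage `n`. Unless it is `β`, the next stage has
  -- a smaller such point, so well-foundedness ends the walk.
  have key : ∀ a n, a ∈ walk e X n → β ≤ a → (∀ x ∈ walk e X n, β ≤ x → a ≤ x) →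
      ∃ m, β ∈ walk e X m := by
    intro a
    induction a using WellFoundedLT.induction with
    | ind a ih =>
      intro n ha hle hmin
      rcases hle.eq_or_lt with rfl | hlt
      · exact ⟨n, ha⟩
      obtain ⟨c, hc, h1, h2⟩ := he a (walk_subset_Iio hXΛ n ha) β hlt
      have hcw : c ∈ walk e X (n + 1) :=
        .inr ⟨a, ha, hc, h2, fun x hx hcx => hmin x hx (h1.trans hcx)⟩
      exact ih _ ((next_le hcw h1).trans_lt h2) (n + 1) (next_spec hcw h1).1 (next_spec hcw h1).2
        fun x hx hx' => next_le hx hx'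
  obtain ⟨x, hx, h1, -⟩ := hX.2 β hβ
  exact key (next X β) 0 (next_spec hx h1.le).1 (next_spec hx h1.le).2 fun y hy hy' => next_le hy hy'

/-- A point is a limit of `walk e X n` only if it was reached before stage `n`. -/
theorem LimPt.of_walk {Λ b : Ordinal.{u}} (he : ∀ a < Λ, b < a → ¬ LimPt (e a) b)
    (hXΛ : X ⊆ Iio Λ) {n : ℕ} (h : LimPt (walk e X n) b) :
    LimPt X b ∨ ∃ m < n, b ∈ walk e X m := by
  induction n with
  | zero => exact .inl h
  | succ n ih =>
    by_cases hl : LimPt (walk e X n) b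
    · exact (ih hl).imp_right fun ⟨m, hm, hb⟩ => ⟨m, hm.trans n.lt_succ_self, hb⟩
    by_cases hbn : b ∈ walk e X n
    · exact .inr ⟨n, n.lt_succ_self, hbn⟩
    exfalso
    have : ∃ β < b, ∀ x ∈ walk e X n, β < x → b ≤ x := by
      by_contra! hcon
      exact hl ⟨h.1, fun β hβ => hcon β hβ⟩
    obtain ⟨β, hβ, hgap⟩ := this
    -- The gap `(β, b)` is empty at stage `n`, so all new points in it come from one set `e a`, with
    -- `a` the next point above `b`. Then `b` would be a limit of `e a`, contrary to `he`.
    have key : ∀ x ∈ walk e X (n + 1), β < x → x < b →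
        next (walk e X n) b ∈ walk e X n ∧ b < next (walk e X n) b ∧
          x ∈ e (next (walk e X n) b) := by
      rintro x (hx | ⟨a, ha, h1, h2, h3⟩) hβx hxb
      · exact absurd hxb (hgap x hx hβx).not_gt
      · have hba := hgap a ha (hβx.trans h2)
        rw [next_eq ha hba fun y hy hby => h3 y hy (hxb.le.trans hby)]
        exact ⟨ha, lt_of_le_of_ne hba fun h => hbn (h ▸ ha), h1⟩
    obtain ⟨x, hx, h1, h2⟩ := h.2 β hβ
    obtain ⟨h3, h4, -⟩ := key x hx h1 h2
    refine he _ (walk_subset_Iio hXΛ n h3) h4 ⟨h.1, fun γ hγ => ?_⟩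
    obtain ⟨y, hy, h5, h6⟩ := h.2 (max β γ) (max_lt hβ hγ)
    exact ⟨y, (key y hy ((le_max_left _ _).trans_lt h5) h6).2.2, (le_max_right _ _).trans_lt h5, h6⟩

/-- The fibre of `next X` over `a` is a part of `e a`, of type at most `L`, with `a` on top. -/
theorem Ranked.step {Λ L μ : Ordinal.{u}} (he : ∀ a < Λ, Ranked (e a) L) (hXΛ : X ⊆ Iio Λ)
    (hX : Ranked X μ) : Ranked (step e X) (succ L * μ) := by
  classical
  choose! r hr hr' using he
  have hspec : ∀ b ∈ ClubGuess.step e X, next X b ∈ X ∧ b ≤ next X b := by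
    rintro b (hb | ⟨a, ha, -, h, -⟩)
    · exact next_spec hb le_rfl
    · exact next_spec ha h.le
  have hmem : ∀ b ∈ ClubGuess.step e X, b ∉ X → b ∈ e (next X b) := by
    rintro b (hb | ⟨a, ha, h1, h2, h3⟩) hbX
    · exact absurd hb hbX
    · rwa [next_eq ha h2.le h3]
  refine hX.of_fibers (f := next X) (g := fun b => if b ∈ X then L else r (next X b) b)
    (fun b hb => (hspec b hb).1)
    (fun b hb c hc hbc => next_le (hspec c hc).1 (hbc.trans (hspec c hc).2)) (fun b hb => ?_)
    (fun b hb c hc hbc heq => ?_)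
  · split_ifs with h
    · exact lt_succ L
    · exact (hr _ (hXΛ (hspec b hb).1) b (hmem b hb h)).trans (lt_succ L)
  · have hb' : b ∉ X := fun hbX => by
      have := next_le hbX le_rfl
      rw [heq] at this
      exact (hbc.trans_le ((hspec c hc).2.trans this)).false
    simp only [hb', if_false]
    split_ifs with h
    · exact hr _ (hXΛ (hspec b hb).1) b (hmem b hb hb')
    · rw [heq]
      refine hr' _ (hXΛ (hspec c hc).1) ?_ (hmem c hc h) hbc
      rw [← heq]; exact hmem b hb hb'

/-- Multiplicative indecomposability of `l ^ ω` is what makes this bound survive every finite number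
of walk steps. -/
theorem mul_lt_opow_omega0 {l a b : Ordinal.{u}} (hl : 1 < l) (ha : a < l ^ ω) (hb : b < l ^ ω) :
    a * b < l ^ ω := by
  have h0 : l ≠ 0 := (zero_lt_one.trans hl).ne'
  obtain ⟨c, hc, hac⟩ := (lt_opow_of_isSuccLimit h0 isSuccLimit_omega0).1 ha
  obtain ⟨d, hd, hbd⟩ := (lt_opow_of_isSuccLimit h0 isSuccLimit_omega0).1 hb
  calc a * b ≤ l ^ c * b := by gcongr
    _ < l ^ c * l ^ d := by gcongr; exact opow_pos _ (zero_lt_one.trans hl)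
    _ = l ^ (c + d) := (opow_add _ _ _).symm
    _ < l ^ ω := (opow_lt_opow_iff_right hl).2 (isPrincipal_add_omega0 hc hd)

theorem Ranked.walk {Λ l μ : Ordinal.{u}} (he : ∀ a < Λ, Ranked (e a) l) (hl : ω ≤ l)
    (hXΛ : X ⊆ Iio Λ) (hX : Ranked X μ) (hμ : μ < l ^ ω) (n : ℕ) :
    ∃ ν < l ^ ω, Ranked (walk e X n) ν := by
  have h1 : 1 < l := one_lt_omega0.trans_le hl
  induction n with
  | zero => exact ⟨μ, hμ, hX⟩
  | succ n ih =>
    obtain ⟨ν, hν, h⟩ := ih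
    refine ⟨_, mul_lt_opow_omega0 h1 ?_ hν, h.step he (walk_subset_Iio hXΛ n)⟩
    exact (isSuccLimit_opow h1 isSuccLimit_omega0).succ_lt (left_lt_opow h1 one_lt_omega0)

end Walk

/-! ### Sequences guessing the clubs of `κ` -/

theorem exists_ladder {x : Ordinal.{u}} (hx : x.cof = ℵ₀) :
    ∃ c : ℕ → Ordinal.{u}, (∀ k, c k < x) ∧ ∀ β < x, ∃ k, β ≤ c k := by
  obtain ⟨q, -, h1, h2⟩ := exists_monotone_cofinal x
  rw [hx, ord_aleph0] at h1 h2
  refine ⟨fun k => q k, fun k => h1 _ (natCast_lt_omega0 k), fun β hβ => ?_⟩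
  obtain ⟨y, hy, hle⟩ := h2 one_lt_aleph0.ne' β hβ
  obtain ⟨n, rfl⟩ := lt_omega0.1 hy
  exact ⟨n, hle⟩

/-- The limits of countable cofinality of a club. -/
theorem Clb.exists_limPt_cof_eq_aleph0 {δ : Ordinal.{u}} (hδ : ℵ₀ < δ.cof) {C : Set Ordinal.{u}}
    (hC : Clb δ C) : ∃ x < δ, LimPt C x ∧ x.cof = ℵ₀ := by
  obtain ⟨f, hf, hfC⟩ := hC.1.exists_strictMono
  refine ⟨⨆ n, f n, lift_iSup_lt_of_lt_cof (by simpa using hδ) fun n => (hfC n).2, ⟨?_, ?_⟩, ?_⟩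
  · exact (bot_le.trans_lt ((hf Nat.zero_lt_one).trans_le (Ordinal.le_iSup f 1))).ne'
  · intro β hβ
    obtain ⟨n, hn⟩ := Ordinal.lt_iSup_iff.1 hβ
    exact ⟨f n, (hfC n).1, hn, (hf n.lt_succ_self).trans_le (Ordinal.le_iSup f (n + 1))⟩
  · have := lift_cof_iSup.{u, 0} hf
    simpa using this

/-- Club guessing for points of countable cofinality, for a ladder system `c`: the ladders are
projected to a suitable club `D`. -/
theorem exists_club_guessing {κ : Ordinal.{u}} (hκ : ℵ₁ < κ.cof) (c : Ordinal.{u} → ℕ → Ordinal.{u})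
    (hc : ∀ x, x.cof = ℵ₀ → ∀ k, c x k < x) :
    ∃ D, Clb κ D ∧ ∀ D', Clb κ D' → ∃ x < κ, LimPt D x ∧ x.cof = ℵ₀ ∧
      ∀ k, 0 < sSup (D ∩ Iic (c x k)) → sSup (D ∩ Iic (c x k)) ∈ D' := by
  by_contra! hcon
  have hκ0 : ℵ₀ < κ.cof := aleph0_lt_aleph_one.trans hκ
  choose! Φ hΦ hbad using hcon
  -- If every club `D` fails, with witness `Φ D`, iterate `Φ` along `ω₁`, intersecting all earlier
  -- witnesses. At a fixed `x` each projection decreases with the stage, so the countably many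
  -- projections are all constant from some `γ < ω₁` on. They then lie in `D (succ γ) ⊆ Φ (D γ)`, a
  -- contradiction.
  let D : Ordinal.{u} → Set Ordinal.{u} :=
    WellFoundedLT.fix fun α ih => {x | ∀ β, ∀ h : β < α, x ∈ Φ (ih β h)}
  have hD : ∀ α, D α = {x | ∀ β ∈ Iio α, x ∈ Φ (D β)} := fun α => by
    change WellFoundedLT.fix _ α = _
    rw [WellFoundedLT.fix_eq]
    rfl
  have hmk : ∀ α ≤ (ℵ₁ : Cardinal.{u}).ord, #(Iio α) < Cardinal.lift.{u + 1} κ.cof := by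
    intro α hα
    rw [Cardinal.mk_Iio_ordinal, Cardinal.lift_lt]
    exact (Ordinal.card_le_card hα).trans_lt (by rwa [card_ord])
  have hclub : ∀ α ≤ (ℵ₁ : Cardinal.{u}).ord, Clb κ (D α) := by
    intro α
    induction α using WellFoundedLT.induction with
    | ind α ih =>
      intro hα
      rw [hD]
      exact Clb.iInter hκ0 (hmk α hα) fun β hβ => hΦ _ (ih β hβ ((le_of_lt hβ).trans hα))
  have hanti : ∀ α β, α ≤ β → D β ⊆ D α := by
    intro α β h x hx
    rw [hD] at hx ⊢
    exact fun γ hγ => hx γ (lt_of_lt_of_le hγ h)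
  have hsucc : ∀ α, D (succ α) ⊆ Φ (D α) := by
    intro α x hx
    rw [hD] at hx
    exact hx α (lt_succ α)
  obtain ⟨x, hx, hlim, hcof⟩ := (hclub _ le_rfl).exists_limPt_cof_eq_aleph0 hκ0
  have hlim' : ∀ α ≤ (ℵ₁ : Cardinal.{u}).ord, LimPt (D α) x :=
    fun α hα => hlim.mono fun y hy _ => hanti _ _ hα hy
  let g : ℕ → Ordinal.{u} → Ordinal.{u} := fun k α => sSup (D α ∩ Iic (c x k))
  have hstab : ∀ k, ∃ α < (ℵ₁ : Cardinal.{u}).ord, ∀ β < (ℵ₁ : Cardinal.{u}).ord, g k α ≤ g k β := by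
    intro k
    obtain ⟨α, hα, hmin⟩ := WellFounded.has_min (wellFounded_lt (α := Ordinal.{u}))
      (g k '' Iio (ℵ₁ : Cardinal.{u}).ord) ⟨_, mem_image_of_mem _ (mem_Iio.2 isRegular_aleph_one.ord_pos)⟩
    obtain ⟨β, hβ, rfl⟩ := hα
    exact ⟨β, hβ, fun γ hγ => not_lt.1 (hmin _ (mem_image_of_mem _ hγ))⟩
  choose a ha hamin using hstab
  have hcof1 : ℵ₀ < (ℵ₁ : Cardinal.{u}).ord.cof := by
    rw [isRegular_aleph_one.cof_ord]; exact aleph0_lt_aleph_one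
  obtain ⟨γ, hγ, hle⟩ := exists_lt_forall_nat_le hcof1 ha
  have hγ' : succ γ < (ℵ₁ : Cardinal.{u}).ord :=
    (Cardinal.isSuccLimit_ord isRegular_aleph_one.aleph0_le).succ_lt hγ
  have hgne : ∀ k α, 0 < g k α → (D α ∩ Iic (c x k)).Nonempty := by
    intro k α h
    by_contra he
    simp only [g, not_nonempty_iff_eq_empty.1 he, csSup_empty] at h
    exact h.not_ge bot_le
  have hgmono : ∀ k α β, α ≤ β → g k β ≤ g k α := by
    intro k α β h
    rcases (bot_le : 0 ≤ g k β).eq_or_lt with h0 | h0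
    · rw [← h0]; exact bot_le
    · exact csSup_le_csSup ⟨c x k, fun y hy => hy.2⟩ (hgne k β h0)
        (inter_subset_inter_left _ (hanti _ _ h))
  obtain ⟨k, hpos, hk⟩ := hbad _ (hclub γ hγ.le) x hx (hlim' γ hγ.le) hcof
  refine hk ?_
  have heq : g k γ = g k (succ γ) :=
    ((hgmono k _ _ (hle k)).trans (hamin k _ hγ')).antisymm (hgmono k _ _ (le_succ γ))
  change g k γ ∈ _
  rw [heq]
  exact hsucc γ ((hclub _ hγ'.le).sSup_mem inter_subset_left
    (hgne k _ (heq ▸ hpos)) ((hc x hcof k).trans hx) fun y hy => hy.2)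

/-- `F` lists fewer than `λ⁺` increasing sequences such that every club of `κ` contains one. -/
def GuessesSeq (lam κ : Cardinal.{u}) (F : Ordinal.{u} → ℕ → Ordinal.{u}) : Prop :=
  ∀ D, Clb κ.ord D → ∃ j < lam.ord, StrictMono (F j) ∧ ∀ n, F j n ∈ D ∧ F j n < κ.ord

/-- The projection to `D` of a ladder at a limit `x` of `D` is still cofinal in `x`, so it can be
thinned to an increasing sequence. The index of that sequence is `x` itself. -/
theorem exists_guessesSeq_of_aleph_one_lt {lam κ : Cardinal.{u}} (hκ : κ.IsRegular)
    (hκ1 : ℵ₁ < κ) (hlam : κ < lam) : ∃ F, GuessesSeq lam κ F := by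
  have hlad : ∀ x : Ordinal.{u}, ∃ c : ℕ → Ordinal.{u}, x.cof = ℵ₀ →
      (∀ k, c k < x) ∧ ∀ β < x, ∃ k, β ≤ c k := fun x => by
    by_cases h : x.cof = ℵ₀
    · obtain ⟨c, hc⟩ := exists_ladder h
      exact ⟨c, fun _ => hc⟩
    · exact ⟨fun _ => 0, fun h' => absurd h' h⟩
  choose c hc using hlad
  obtain ⟨D, -, hguess⟩ := exists_club_guessing (κ := κ.ord) (by rwa [hκ.cof_ord]) c
    fun x hx => (hc x hx).1
  have hseq : ∀ x : Ordinal.{u}, ∃ f : ℕ → Ordinal.{u}, LimPt D x → x.cof = ℵ₀ →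
      StrictMono f ∧ ∀ n, f n < x ∧ ∃ k, 0 < sSup (D ∩ Iic (c x k)) ∧
        f n = sSup (D ∩ Iic (c x k)) := fun x => by
    by_cases h : LimPt D x ∧ x.cof = ℵ₀
    · have : LimPt {y | ∃ k, 0 < sSup (D ∩ Iic (c x k)) ∧ y = sSup (D ∩ Iic (c x k))} x := by
        refine ⟨h.1.1, fun β hβ => ?_⟩
        obtain ⟨d, hd, h1, h2⟩ := h.1.2 β hβ
        obtain ⟨k, hk⟩ := (hc x h.2).2 d h2
        have hle : d ≤ sSup (D ∩ Iic (c x k)) := le_csSup ⟨c x k, fun y hy => hy.2⟩ ⟨hd, hk⟩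
        refine ⟨_, ⟨k, bot_le.trans_lt (h1.trans_le hle), rfl⟩, h1.trans_le hle, ?_⟩
        have hge : sSup (D ∩ Iic (c x k)) ≤ c x k := csSup_le ⟨d, hd, hk⟩ fun y hy => hy.2
        exact hge.trans_lt ((hc x h.2).1 k)
      obtain ⟨f, hf, hf'⟩ := this.exists_strictMono
      exact ⟨f, fun _ _ => ⟨hf, fun n => ⟨(hf' n).2, (hf' n).1⟩⟩⟩
    · exact ⟨fun _ => 0, fun h1 h2 => absurd ⟨h1, h2⟩ h⟩
  choose F hF using hseq
  refine ⟨F, fun D' hD' => ?_⟩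
  obtain ⟨x, hx, hl, hcof, hk⟩ := hguess D' hD'
  obtain ⟨h1, h2⟩ := hF x hl hcof
  refine ⟨x, hx.trans (ord_lt_ord.2 hlam), h1, fun n => ⟨?_, (h2 n).1.trans hx⟩⟩
  obtain ⟨k, hpos, heq⟩ := (h2 n).2
  rw [heq]
  exact hk k hpos

/-- Since `ℵ₁ ^ ℵ₀ = 2 ^ ℵ₀ ≤ λ`, all `ω`-sequences in `ω₁` can be listed. -/
theorem exists_guessesSeq_aleph_one {lam : Cardinal.{u}}
    (hlam : (2 : Cardinal.{u}) ^ (ℵ₀ : Cardinal.{u}) ≤ lam) : ∃ F, GuessesSeq lam ℵ₁ F := by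
  have hle : #(ℕ → (ℵ₁ : Cardinal.{u}).ord.ToType) ≤ #lam.ord.ToType := by
    have : (ℵ₁ : Cardinal.{u}) ≤ 2 ^ (ℵ₀ : Cardinal.{u}) := by
      rw [← succ_aleph0]; exact succ_le_of_lt (cantor _)
    calc #(ℕ → (ℵ₁ : Cardinal.{u}).ord.ToType) = ℵ₁ ^ (ℵ₀ : Cardinal.{u}) := by simp
      _ ≤ (2 ^ (ℵ₀ : Cardinal.{u})) ^ (ℵ₀ : Cardinal.{u}) := power_le_power_right this
      _ = 2 ^ (ℵ₀ : Cardinal.{u}) := by rw [← power_mul, aleph0_mul_aleph0]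
      _ ≤ #lam.ord.ToType := by simpa using hlam
  obtain ⟨φ⟩ := hle
  have : Nonempty (ℕ → (ℵ₁ : Cardinal.{u}).ord.ToType) :=
    ⟨fun _ => ToType.mk ⟨0, mem_Iio.2 isRegular_aleph_one.ord_pos⟩⟩
  classical
  let F : Ordinal.{u} → ℕ → Ordinal.{u} := fun j n =>
    if h : j < lam.ord then (ToType.mk.symm (Function.invFun φ (ToType.mk ⟨j, h⟩) n)).1 else 0
  refine ⟨F, fun D hD => ?_⟩
  obtain ⟨f, hf, hfD⟩ := hD.1.exists_strictMono
  let y := φ fun n => ToType.mk ⟨f n, (hfD n).2⟩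
  have hy : F (ToType.mk.symm y).1 = f := by
    funext n
    have h : (ToType.mk.symm y).1 < lam.ord := (ToType.mk.symm y).2
    simp only [F, dif_pos h]
    have : ToType.mk ⟨(ToType.mk.symm y).1, h⟩ = y := ToType.mk.apply_symm_apply y
    rw [this, Function.leftInverse_invFun φ.injective]
    simp
  exact ⟨_, (ToType.mk.symm y).2, hy ▸ hf, hy ▸ hfD⟩

/-! ### Collapsing maps -/

open Classical in
/-- The collapsing map of `B`, defined on all ordinals: `coll B x` is the order type of
`B ∩ Iio x`. -/
noncomputable def coll (B : Set Ordinal.{u}) : Ordinal.{u} → Ordinal.{u} :=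
  WellFoundedLT.fix fun x ih => ⨆ y : Iio x, if y.1 ∈ B then succ (ih y.1 y.2) else 0

theorem lt_coll_iff {B : Set Ordinal.{u}} {x p : Ordinal.{u}} :
    p < coll B x ↔ ∃ y ∈ B, y < x ∧ p ≤ coll B y := by
  classical
  have : coll B x = ⨆ y : Iio x, if y.1 ∈ B then succ (coll B y.1) else 0 := by
    change WellFoundedLT.fix _ x = _
    rw [WellFoundedLT.fix_eq]
    rfl
  rw [this, Ordinal.lt_iSup_iff]
  constructor
  · rintro ⟨⟨y, hy⟩, h⟩
    by_cases hB : y ∈ B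
    · rw [if_pos hB] at h
      exact ⟨y, hB, hy, lt_succ_iff.1 h⟩
    · rw [if_neg hB] at h
      exact absurd h (not_lt_of_ge bot_le)
  · rintro ⟨y, hB, hy, h⟩
    exact ⟨⟨y, hy⟩, by rw [if_pos hB]; exact lt_succ_iff.2 h⟩

theorem coll_monotone (B : Set Ordinal.{u}) : Monotone (coll B) := fun x y hxy =>
  le_of_forall_lt fun p hp => by
    rw [lt_coll_iff] at *
    obtain ⟨z, h1, h2, h3⟩ := hp
    exact ⟨z, h1, h2.trans_le hxy, h3⟩

theorem coll_lt_coll {B : Set Ordinal.{u}} {x y : Ordinal.{u}} (hx : x ∈ B) (h : x < y) :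
    coll B x < coll B y :=
  lt_coll_iff.2 ⟨x, hx, h, le_rfl⟩

/-- Used to replace the piece of `δ` by the piece of `x`, so that the colour of `x` can be defined
without mentioning `δ`. -/
theorem coll_congr {B B' : Set Ordinal.{u}} {δ : Ordinal.{u}} (h : B ∩ Iio δ = B' ∩ Iio δ)
    {x : Ordinal.{u}} (hx : x ≤ δ) : coll B x = coll B' x := by
  induction x using WellFoundedLT.induction with
  | ind x ih =>
    have hB : ∀ y < x, (y ∈ B ↔ y ∈ B') := fun y hy => by
      have := Set.ext_iff.1 h y
      simpa [hy.trans_le hx] using this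
    refine eq_of_forall_lt_iff fun p => ?_
    rw [lt_coll_iff, lt_coll_iff]
    constructor
    · rintro ⟨y, h1, h2, h3⟩
      exact ⟨y, (hB y h2).1 h1, h2, by rwa [← ih y h2 (h2.le.trans hx)]⟩
    · rintro ⟨y, h1, h2, h3⟩
      exact ⟨y, (hB y h2).2 h1, h2, by rwa [ih y h2 (h2.le.trans hx)]⟩

theorem coll_lt {lam : Cardinal.{u}} (hlam : lam.IsRegular) {B : Set Ordinal.{u}}
    (hB : #B < Cardinal.lift.{u + 1} lam) (x : Ordinal.{u}) : coll B x < lam.ord := by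
  induction x using WellFoundedLT.induction with
  | ind x ih =>
    obtain ⟨γ, hγ, hle⟩ := exists_lt_forall_le (δ := lam.ord) (I := B ∩ Iio x) (g := coll B)
      (by rw [hlam.cof_ord]; exact (mk_le_mk_of_subset inter_subset_left).trans_lt hB)
      fun y hy => ih y hy.2
    refine lt_of_le_of_lt (le_of_forall_lt fun p hp => ?_)
      ((Cardinal.isSuccLimit_ord hlam.aleph0_le).succ_lt hγ)
    obtain ⟨y, h1, h2, h3⟩ := lt_coll_iff.1 hp
    exact lt_succ_iff.2 (h3.trans (hle y ⟨h1, h2⟩))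

theorem ranked_of_mk_lt {lam : Cardinal.{u}} (hlam : lam.IsRegular) {B : Set Ordinal.{u}}
    (hB : #B < Cardinal.lift.{u + 1} lam) : Ranked B lam.ord :=
  ⟨coll B, fun x _ => coll_lt hlam hB x, fun _ hx _ _ h => coll_lt_coll hx h⟩

/-! ### Fodor's lemma and splitting of stationary sets -/

theorem clb_Ioi {δ γ : Ordinal.{u}} (hδ : IsSuccLimit δ) (hγ : γ < δ) : Clb δ (Ioi γ) := by
  refine ⟨⟨hδ.ne_bot, fun β hβ => ⟨succ (max β γ), ?_, ?_, hδ.succ_lt (max_lt hβ hγ)⟩⟩,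
    fun x _ hx => ?_⟩
  · exact mem_Ioi.2 (lt_succ_iff.2 (le_max_right _ _))
  · exact lt_succ_iff.2 (le_max_left _ _)
  · obtain ⟨y, hy, -, h⟩ := hx.2 0 (pos_iff_ne_zero.2 hx.1)
    exact lt_trans hy h

/-- Fodor's lemma for ordinals of uncountable cofinality: a regressive function on a stationary set
is bounded on a stationary set. -/
theorem Stat.exists_bounded {δ : Ordinal.{u}} (hδ : ℵ₀ < δ.cof) {T : Set Ordinal.{u}}
    (hT : Stat δ T) {g : Ordinal.{u} → Ordinal.{u}} (hg : ∀ x ∈ T, g x < x) :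
    ∃ γ < δ, Stat δ {x ∈ T | g x ≤ γ} := by
  by_contra! hcon
  have hD : ∀ γ < δ, ∃ D, Clb δ D ∧ ∀ x ∈ T, g x ≤ γ → x ∈ D → δ ≤ x := by
    intro γ hγ
    have := hcon γ hγ
    simp only [Stat, not_forall, not_exists, not_and, not_lt] at this
    obtain ⟨D, hD, h⟩ := this
    exact ⟨D, hD, fun x hx hq hc => h x ⟨hx, hq⟩ hc⟩
  choose! D hD hdisj using hD
  have hl := isSuccLimit_of_aleph0_le_cof hδ.le
  obtain ⟨s, hs, hcof, r, hr, hr'⟩ := exists_cofinal_ranked δ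
  have hslim : LimPt s δ := ⟨hl.ne_bot, fun β hβ =>
    let ⟨x, hx, h⟩ := hcof _ (hl.succ_lt hβ); ⟨x, hx, (lt_succ β).trans_le h, hs hx⟩⟩
  -- A diagonal intersection indexed by `s` only: below any point fewer than `cf δ` clubs are
  -- intersected, so `δ` need not be regular.
  have hK := clb_setOf_closed hδ (R := fun x z => ∀ y ∈ s ∩ Iic x, z ∈ D y)
    (fun x' x z hx _ h y hy => h y ⟨hy.1, hy.2.trans hx⟩) (fun x hx => by
      have hmk : #(s ∩ Iic x : Set Ordinal.{u}) < Cardinal.lift.{u + 1} δ.cof := by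
        obtain ⟨w, hw, h1, -⟩ := hslim.2 x hx
        refine (Ranked.mk_le (μ := r w) ⟨r, fun y hy => hr' hy.1 hw (lt_of_le_of_lt hy.2 h1),
          hr'.mono inter_subset_left⟩).trans_lt ?_
        rw [Cardinal.lift_lt]
        exact lt_ord.1 (hr w hw)
      obtain ⟨z, hz, h1, h2⟩ := (Clb.iInter hδ hmk fun y hy => hD y (hs hy.1)).1.2 x hx
      exact ⟨z, h2, h1, hz⟩)
  obtain ⟨x, hx, ⟨hxK, hxs⟩, hxδ⟩ := hT _ (hK.inter hδ (clb_limPt hδ hslim))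
  obtain ⟨w, hw, h1, h2⟩ := hxs.2 _ (hg x hx)
  refine (hdisj w (hs hw) x hx h1.le ((hD w (hs hw)).2 x hxδ ⟨hxK.1, fun β hβ => ?_⟩)).not_gt hxδ
  obtain ⟨z, hz, h3, h4⟩ := hxK.2 _ (max_lt hβ h2)
  exact ⟨z, h4 w ⟨hw, mem_Iic.2 (le_max_right _ _)⟩, (le_max_left _ _).trans_lt h3, hz⟩

/-- Some coordinate of a ladder system of length less than `cf δ` splits a stationary subset of `δ`
into unboundedly many stationary pieces. -/
theorem Stat.exists_ladder_split {δ : Ordinal.{u}} (hδ : ℵ₀ < δ.cof) {θ : Cardinal.{u}}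
    (hθ : θ < δ.cof) {S : Set Ordinal.{u}} (hS : Stat δ S)
    {η : Ordinal.{u} → Ordinal.{u} → Ordinal.{u}} (hη : ∀ x ∈ S, ∀ ζ < θ.ord, η x ζ < x)
    (hη' : ∀ x ∈ S, ∀ β < x, ∃ ζ < θ.ord, β ≤ η x ζ) :
    ∃ ζ < θ.ord, ∀ γ < δ, ∃ γ' < δ, Stat δ {x ∈ S | γ < η x ζ ∧ η x ζ ≤ γ'} := by
  have hl := isSuccLimit_of_aleph0_le_cof hδ.le
  have hI : #(Iio θ.ord) < Cardinal.lift.{u + 1} δ.cof := mk_Iio_lt (ord_lt_ord.2 hθ)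
  -- Otherwise each coordinate is bounded off a nonstationary set. As `θ < cf δ` there is a common
  -- bound, yet each ladder above it exceeds it at some coordinate, and one coordinate does so
  -- stationarily often.
  have h1 : ∃ ζ < θ.ord, ∀ γ < δ, Stat δ {x ∈ S | γ < η x ζ} := by
    by_contra! hcon
    choose! g hg hg' using hcon
    obtain ⟨γ, hγ, hle⟩ := exists_lt_forall_le hI hg
    obtain ⟨ζ, hζ, hst⟩ := (hS.inter hδ (clb_Ioi hl (hl.succ_lt hγ))).exists_of_forall hδ hI
      (Q := fun ζ x => succ γ ≤ η x ζ) fun x hx _ => hη' x hx.1 _ hx.2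
    exact hg' ζ hζ (hst.mono fun x hx _ =>
      ⟨hx.1.1, (hle ζ hζ).trans_lt ((lt_succ γ).trans_le hx.2)⟩)
  obtain ⟨ζ, hζ, h⟩ := h1
  refine ⟨ζ, hζ, fun γ hγ => ?_⟩
  obtain ⟨γ', hγ', hst⟩ := (h γ hγ).exists_bounded hδ (g := fun x => η x ζ)
    fun x hx => hη x hx.1 ζ hζ
  exact ⟨γ', hγ', hst.mono fun x hx _ => ⟨hx.1.1, hx.1.2, hx.2⟩⟩

/-! ### Decompositions of the ordinals below `λ⁺` into small pieces -/

theorem mk_lt_of_injOn {lam : Cardinal.{u}} {s : Set Ordinal.{u}} {o : Ordinal.{u}}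
    (ho : o < lam.ord) {g : Ordinal.{u} → Ordinal.{u}} (hg : ∀ x ∈ s, g x < o)
    (hinj : InjOn g s) : #s < Cardinal.lift.{u + 1} lam := by
  refine (Cardinal.mk_le_of_injective (f := fun x : s => (⟨g x.1, hg x.1 x.2⟩ : Iio o))
    fun a b hab => ?_).trans_lt (mk_Iio_lt ho)
  exact Subtype.ext (hinj a.2 b.2 (congrArg Subtype.val hab))

/-- Injections of the ordinals below `λ⁺` into `λ`. -/
theorem exists_injections (lam : Cardinal.{u}) :
    ∃ f : Ordinal.{u} → Ordinal.{u} → Ordinal.{u}, ∀ δ < (succ lam).ord,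
      (∀ ξ < δ, f δ ξ < lam.ord) ∧ InjOn (f δ) (Iio δ) := by
  have : ∀ δ : Ordinal.{u}, ∃ f : Ordinal.{u} → Ordinal.{u}, δ < (succ lam).ord →
      (∀ ξ < δ, f ξ < lam.ord) ∧ InjOn f (Iio δ) := by
    intro δ
    by_cases hδ : δ < (succ lam).ord
    · have hle : #(Iio δ) ≤ #(Iio lam.ord) := by
        rw [Cardinal.mk_Iio_ordinal, Cardinal.mk_Iio_ordinal, Cardinal.lift_le, card_ord]
        exact lt_succ_iff.1 (lt_ord.1 hδ)
      obtain ⟨φ⟩ := hle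
      classical
      refine ⟨fun ξ => if h : ξ < δ then (φ ⟨ξ, mem_Iio.2 h⟩).1 else 0, fun _ => ⟨fun ξ hξ => ?_, ?_⟩⟩
      · simp only [dif_pos hξ]; exact (φ ⟨ξ, hξ⟩).2
      · intro a ha b hb hab
        have ha' : a < δ := ha
        have hb' : b < δ := hb
        simp only [dif_pos ha', dif_pos hb'] at hab
        exact congrArg Subtype.val (φ.injective (Subtype.ext hab))
    · exact ⟨id, fun h => absurd h hδ⟩
  choose f hf using this
  exact ⟨f, hf⟩

section Pieces

variable {lam : Cardinal.{u}} {f : Ordinal.{u} → Ordinal.{u} → Ordinal.{u}}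

/-- The piece of index `i` of the decomposition of `δ` given by `f`. -/
def piece (f : Ordinal.{u} → Ordinal.{u} → Ordinal.{u}) (δ i : Ordinal.{u}) : Set Ordinal.{u} :=
  {ξ | ξ < δ ∧ f δ ξ < i}

theorem mk_piece_lt
    (hf : ∀ δ < (succ lam).ord, (∀ ξ < δ, f δ ξ < lam.ord) ∧ InjOn (f δ) (Iio δ))
    {δ i : Ordinal.{u}} (hδ : δ < (succ lam).ord) (hi : i < lam.ord) :
    #(piece f δ i) < Cardinal.lift.{u + 1} lam :=
  mk_lt_of_injOn hi (g := f δ) (fun _ hx => hx.2) ((hf δ hδ).2.mono fun _ hx => hx.1)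

/-- Any fewer than `λ` of the decompositions cohere at some index. -/
theorem exists_piece_coherent (hlam : lam.IsRegular) (h0 : ℵ₀ < lam)
    (hf : ∀ δ < (succ lam).ord, (∀ ξ < δ, f δ ξ < lam.ord) ∧ InjOn (f δ) (Iio δ))
    {δ : Ordinal.{u}} (hδ : δ < (succ lam).ord) {C : Set Ordinal.{u}} (hC : C ⊆ Iio δ)
    (hmk : #C < Cardinal.lift.{u + 1} lam) :
    ∃ i < lam.ord, C ⊆ piece f δ i ∧ ∀ x ∈ C, piece f x i = piece f δ i ∩ Iio x := by
  have hcof : lam.ord.cof = lam := hlam.cof_ord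
  have hl : IsSuccLimit lam.ord := Cardinal.isSuccLimit_ord hlam.aleph0_le
  have hbd : ∀ (x y v : Ordinal.{u}), x ≤ δ → y ≤ δ → v < lam.ord →
      ∃ γ < lam.ord, ∀ ξ < x, ξ < y → f x ξ ≤ v → f y ξ ≤ γ := by
    intro x y v hx hy hv
    have hxΛ := hf x (hx.trans_lt hδ)
    obtain ⟨γ, hγ, hle⟩ := exists_lt_forall_le (δ := lam.ord) (I := {ξ | ξ < x ∧ ξ < y ∧ f x ξ ≤ v})
      (g := f y) (by
        rw [hcof]
        exact mk_lt_of_injOn (hl.succ_lt hv) (g := f x) (fun _ h => lt_succ_iff.2 h.2.2)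
          (hxΛ.2.mono fun _ h => h.1)) fun ξ h => (hf y (hy.trans_lt hδ)).1 ξ h.2.1
    exact ⟨γ, hγ, fun ξ h1 h2 h3 => hle ξ ⟨h1, h2, h3⟩⟩
  -- At a closure point `i`, the conditions `f x ξ < i` and `f δ ξ < i` are equivalent for all `x ∈
  -- C` and `ξ < x`, which is coherence.
  have hK := clb_setOf_closed (δ := lam.ord) (by rwa [hcof])
    (R := fun v w => ∀ x ∈ C, ∀ ξ < x, (f x ξ ≤ v → f δ ξ < w) ∧ (f δ ξ ≤ v → f x ξ < w))
    (fun v' v w hv _ h x hx ξ hξ =>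
      ⟨fun h' => (h x hx ξ hξ).1 (h'.trans hv), fun h' => (h x hx ξ hξ).2 (h'.trans hv)⟩)
    (fun v hv => by
      have h1 : ∀ x ∈ C, ∃ γ < lam.ord, ∀ ξ < x, (f x ξ ≤ v → f δ ξ ≤ γ) ∧
          (f δ ξ ≤ v → f x ξ ≤ γ) := by
        intro x hx
        have hxδ : x < δ := hC hx
        obtain ⟨γ, hγ, h⟩ := hbd x δ v hxδ.le le_rfl hv
        obtain ⟨γ', hγ', h'⟩ := hbd δ x v le_rfl hxδ.le hv
        exact ⟨max γ γ', max_lt hγ hγ', fun ξ hξ =>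
          ⟨fun e => (h ξ hξ (hξ.trans hxδ) e).trans (le_max_left _ _),
            fun e => (h' ξ (hξ.trans hxδ) hξ e).trans (le_max_right _ _)⟩⟩
      choose! g hg hg' using h1
      obtain ⟨γ, hγ, hle⟩ := exists_lt_forall_le (δ := lam.ord) (by rwa [hcof]) hg
      refine ⟨succ (max v γ), hl.succ_lt (max_lt hv hγ), lt_succ_iff.2 (le_max_left _ _),
        fun x hx ξ hξ => ⟨fun e => ?_, fun e => ?_⟩⟩
      · exact lt_succ_iff.2 ((((hg' x hx ξ hξ).1 e).trans (hle x hx)).trans (le_max_right _ _))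
      · exact lt_succ_iff.2 ((((hg' x hx ξ hξ).2 e).trans (hle x hx)).trans (le_max_right _ _)))
  obtain ⟨γ, hγ, hle⟩ := exists_lt_forall_le (δ := lam.ord) (by rwa [hcof])
    fun x hx => (hf δ hδ).1 x (hC hx)
  obtain ⟨i, hi, hγi, hilam⟩ := hK.1.2 γ hγ
  refine ⟨i, hilam, fun x hx => ⟨hC hx, (hle x hx).trans_lt hγi⟩, fun x hx => ?_⟩
  ext ξ
  constructor
  · rintro ⟨h1, h2⟩
    obtain ⟨w, hw, -, h⟩ := hi.2 _ h2
    exact ⟨⟨h1.trans (hC hx), ((h x hx ξ h1).1 le_rfl).trans hw⟩, h1⟩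
  · rintro ⟨⟨h1, h2⟩, h3⟩
    obtain ⟨w, hw, -, h⟩ := hi.2 _ h2
    exact ⟨h3, ((h x hx ξ h3).2 le_rfl).trans hw⟩

end Pieces

/-! ### A colouring with countably many stationary colours -/

/-- `p` is a monotone cofinal map from `κ` into `ε`. -/
def CofinalMap (κ ε : Ordinal.{u}) (p : Ordinal.{u} → Ordinal.{u}) : Prop :=
  Monotone p ∧ (∀ x < κ, p x < ε) ∧ ∀ β < ε, ∃ x < κ, β ≤ p x

/-- The number of the interval determined by `c` that contains the collapse of `y`. -/
noncomputable def interval (B : Set Ordinal.{u}) (c : ℕ → Ordinal.{u}) (y : Ordinal.{u}) : ℕ :=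
  sInf {n | coll B y ≤ c (n + 1)}

theorem interval_eq {B : Set Ordinal.{u}} {c : ℕ → Ordinal.{u}} (hc : Monotone c)
    {y : Ordinal.{u}} {n : ℕ} (h1 : c n < coll B y) (h2 : coll B y ≤ c (n + 1)) :
    interval B c y = n := by
  refine le_antisymm (Nat.sInf_le h2) (not_lt.1 fun hlt => ?_)
  have hm : coll B y ≤ c (interval B c y + 1) :=
    Nat.sInf_mem (s := {n | coll B y ≤ c (n + 1)}) ⟨n, h2⟩
  exact (hm.trans (hc hlt)).not_gt h1

/-- The pieces of index `i` cohere on a club of `δ`, and the intervals given by `c`, evaluated at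
the coordinate `ζ` of the ladders, partition `S` into sets stationary in `δ`. -/
def Splits (f η : Ordinal.{u} → Ordinal.{u} → Ordinal.{u}) (S : Set Ordinal.{u}) (c : ℕ → Ordinal.{u})
    (i ζ δ : Ordinal.{u}) : Prop :=
  LimPt (piece f δ i) δ ∧
  (∃ C, Clb δ C ∧ ∀ x ∈ C, x < δ → piece f x i = piece f δ i ∩ Iio x) ∧
  ∀ n, Stat δ {x ∈ S | interval (piece f x i) c (η x ζ) = n}

theorem exists_splits {lam κ θ : Cardinal.{u}} (hlam : lam.IsRegular) (hκ : ℵ₀ < κ) (hκl : κ < lam)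
    (hθ : θ < κ) {f η p : Ordinal.{u} → Ordinal.{u} → Ordinal.{u}}
    (hf : ∀ δ < (succ lam).ord, (∀ ξ < δ, f δ ξ < lam.ord) ∧ InjOn (f δ) (Iio δ))
    {F : Ordinal.{u} → ℕ → Ordinal.{u}} (hF : GuessesSeq lam κ F)
    (hp : ∀ ε, (∃ q, CofinalMap κ.ord ε q) → CofinalMap κ.ord ε (p ε)) {S : Set Ordinal.{u}}
    (hη : ∀ x ∈ S, ∀ ζ < θ.ord, η x ζ < x)
    (hη' : ∀ x ∈ S, ∀ β < x, ∃ ζ < θ.ord, β ≤ η x ζ)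
    {δ : Ordinal.{u}} (hδ : δ < (succ lam).ord) (hcof : δ.cof = κ) (hS : Stat δ S) :
    ∃ i < lam.ord, ∃ ε < lam.ord, ∃ ζ < lam.ord, ∃ j < lam.ord,
      Splits f η S (fun n => p ε (F j n)) i ζ δ := by
  have hδ0 : ℵ₀ < δ.cof := hcof ▸ hκ
  have hl := isSuccLimit_of_aleph0_le_cof hδ0.le
  obtain ⟨s, hs, hscof, hsr⟩ := exists_cofinal_ranked δ
  have hslim : LimPt s δ := ⟨hl.ne_bot, fun β hβ =>
    let ⟨x, hx, h⟩ := hscof _ (hl.succ_lt hβ); ⟨x, hx, (lt_succ β).trans_le h, hs hx⟩⟩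
  have hC : Clb δ (cl δ s) := clb_cl hslim
  have hCmk : #(cl δ s) < Cardinal.lift.{u + 1} lam := by
    refine (hsr.cl hslim).mk_le.trans_lt ?_
    rw [Cardinal.lift_lt, hcof, Ordinal.card_mul, card_ord]
    refine lt_of_le_of_lt ?_ hκl
    have : Ordinal.card 2 ≤ κ := by
      have h2 : Ordinal.card 2 = ((2 : ℕ) : Cardinal.{u}) := by simp
      rw [h2]
      exact natCast_lt_aleph0.le.trans hκ.le
    exact (mul_le_mul_left this κ).trans_eq (mul_eq_self hκ.le)
  obtain ⟨i, hi, hCi, hcoh⟩ := exists_piece_coherent hlam (hκ.trans hκl) hf hδ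
    (fun x (hx : x ∈ cl δ s) => hx.1) hCmk
  set B := piece f δ i with hB
  have hBδ : ∀ x ∈ B, x < δ := fun x hx => hx.1
  have hBlim : LimPt B δ := hC.1.mono fun x hx _ => hCi hx
  set ε := coll B δ with hε
  have hεlam : ε < lam.ord := coll_lt hlam (mk_piece_lt hf hδ hi) δ
  have hltε : ∀ x < δ, coll B x < ε := fun x hx => by
    obtain ⟨y, hy, h1, h2⟩ := hBlim.2 x hx
    exact (coll_monotone B h1.le).trans_lt (coll_lt_coll hy h2)
  obtain ⟨q, hq1, hq2, hq3⟩ := exists_monotone_cofinal δ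
  rw [hcof] at hq2 hq3
  obtain ⟨hp1, hp2, hp3⟩ := hp ε ⟨fun x => coll B (q x), fun x y h => coll_monotone B (hq1 h),
    fun x hx => hltε _ (hq2 x hx), fun β hβ => by
      obtain ⟨y, -, h1, h2⟩ := lt_coll_iff.1 hβ
      obtain ⟨x, hx, h⟩ := hq3 (one_lt_aleph0.trans hκ).ne' y h1
      exact ⟨x, hx, h2.trans (coll_monotone B h)⟩⟩
  -- `d` pulls the cofinal map into `ε` back to `δ`, so intervals of the collapse become intervals
  -- `(d y, d y']` of `δ`.
  let d : Ordinal.{u} → Ordinal.{u} := fun x => sInf {β ∈ B | p ε x ≤ coll B β}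
  have hd : ∀ x < κ.ord, d x ∈ B ∧ p ε x ≤ coll B (d x) := fun x hx => by
    obtain ⟨y, hy, -, h2⟩ := lt_coll_iff.1 (hp2 x hx)
    exact csInf_mem (s := {β ∈ B | p ε x ≤ coll B β}) ⟨y, hy, h2⟩
  have hdlt : ∀ x < κ.ord, ∀ y, p ε x < coll B y ↔ d x < y := fun x hx y => by
    constructor
    · intro h
      obtain ⟨z, h1, h2, h3⟩ := lt_coll_iff.1 h
      exact (csInf_le' (s := {β ∈ B | p ε x ≤ coll B β}) ⟨h1, h3⟩).trans_lt h2
    · exact fun h => (hd x hx).2.trans_lt (coll_lt_coll (hd x hx).1 h)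
  have hdmono : ∀ x y, x ≤ y → y < κ.ord → d x ≤ d y := fun x y h hy =>
    csInf_le' (s := {β ∈ B | p ε x ≤ coll B β}) ⟨(hd y hy).1, (hp1 h).trans (hd y hy).2⟩
  have hdcof : ∀ γ < δ, ∃ x < κ.ord, γ ≤ d x := fun γ hγ => by
    obtain ⟨x, hx, h⟩ := hp3 _ (hltε γ hγ)
    exact ⟨x, hx, not_lt.1 fun h' => ((hdlt x hx γ).2 h').not_ge h⟩
  obtain ⟨ζ, hζ, hsplit⟩ := hS.exists_ladder_split hδ0 (hcof ▸ hθ) hη hη'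
  have hκcof : κ.ord.cof = κ := by rw [← hcof, Ordinal.cof_ord_cof]
  have hκl' : IsSuccLimit κ.ord := Cardinal.isSuccLimit_ord hκ.le
  have hK := clb_setOf_closed (δ := κ.ord) (by rwa [hκcof])
    (R := fun y y' => y' < κ.ord ∧ Stat δ {x ∈ S | d y < η x ζ ∧ η x ζ ≤ d y'})
    (fun y' y z hy hyκ h =>
      ⟨h.1, h.2.mono fun x hx _ => ⟨hx.1, (hdmono _ _ hy hyκ).trans_lt hx.2.1, hx.2.2⟩⟩)
    (fun y hy => by
      obtain ⟨γ, hγ, hst⟩ := hsplit (d y) (hBδ _ (hd y hy).1)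
      obtain ⟨z, hz, h⟩ := hdcof γ hγ
      have hm : max (succ y) z < κ.ord := max_lt (hκl'.succ_lt hy) hz
      exact ⟨max (succ y) z, hm, (lt_succ y).trans_le (le_max_left _ _), hm,
        hst.mono fun x hx _ => ⟨hx.1, hx.2.1,
          (hx.2.2.trans h).trans (hdmono _ _ (le_max_right _ _) hm)⟩⟩)
  obtain ⟨j, hj, hjm, hjK⟩ := hF _ hK
  refine ⟨i, hi, ε, hεlam, ζ, hζ.trans (ord_lt_ord.2 (hθ.trans hκl)), j, hj, hBlim,
    ⟨cl δ s, hC, fun x hx _ => hcoh x hx⟩, fun n => ?_⟩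
  -- Closure of the point `F j (n + 1)` applied to `F j n` gives `y' < F j (n + 1)`, so the `n`-th
  -- interval contains a stationary one.
  obtain ⟨y', hy', -, -, hst⟩ := (hjK (n + 1)).1.2 _ (hjm n.lt_succ_self)
  refine (hst.inter hδ0 hC).mono fun x hx _ => ⟨hx.1.1, ?_⟩
  have heq : coll (piece f x i) (η x ζ) = coll B (η x ζ) := by
    refine coll_congr (δ := x) ?_ (hη x hx.1.1 ζ hζ).le
    rw [hcoh x hx.2, inter_assoc, inter_self]
  refine interval_eq (fun a b h => hp1 (hjm.monotone h)) ?_ ?_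
  · rw [heq, hdlt _ (hjK n).2]
    exact hx.1.2.1
  · rw [heq, ← not_lt, hdlt _ (hjK (n + 1)).2, not_lt]
    exact hx.1.2.2.trans (hdmono _ _ hy'.le (hjK (n + 1)).2)

/-! ### Construction of the guessing sequence -/

theorem exists_ladders {θ : Cardinal.{u}} (hθ : θ ≠ 1) :
    ∃ η : Ordinal.{u} → Ordinal.{u} → Ordinal.{u}, ∀ x, x.cof = θ →
      (∀ ζ < θ.ord, η x ζ < x) ∧ ∀ β < x, ∃ ζ < θ.ord, β ≤ η x ζ := by
  have : ∀ x : Ordinal.{u}, ∃ q : Ordinal.{u} → Ordinal.{u}, x.cof = θ →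
      (∀ ζ < θ.ord, q ζ < x) ∧ ∀ β < x, ∃ ζ < θ.ord, β ≤ q ζ := fun x => by
    obtain ⟨q, -, h1, h2⟩ := exists_monotone_cofinal x
    exact ⟨q, fun h => by subst h; exact ⟨h1, h2 hθ⟩⟩
  choose η hη using this
  exact ⟨η, hη⟩

/-- Cofinal subsets of type at most `λ` of the ordinals below `λ⁺`. -/
theorem exists_cofinal_system (lam : Cardinal.{u}) :
    ∃ e : Ordinal.{u} → Set Ordinal.{u}, ∀ a < (succ lam).ord,
      (∀ b < a, ∃ c ∈ e a, b ≤ c ∧ c < a) ∧ Ranked (e a) lam.ord ∧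
      ∀ b, b.cof = lam → b < a → ¬ LimPt (e a) b := by
  choose e he hcof hr using exists_cofinal_ranked.{u}
  refine ⟨e, fun a ha => ⟨fun b hb => ?_, ?_, fun b hb hba hlim => ?_⟩⟩
  · obtain ⟨c, hc, h⟩ := hcof a b hb
    exact ⟨c, hc, h, he a hc⟩
  · exact (hr a).mono subset_rfl
      (ord_le_ord.2 ((cof_le_card a).trans (lt_succ_iff.1 (lt_ord.1 ha))))
  · have hale : a.cof.ord ≤ lam.ord :=
      ord_le_ord.2 ((cof_le_card a).trans (lt_succ_iff.1 (lt_ord.1 ha)))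
    obtain ⟨r, hr1, hr2⟩ := hr a
    obtain ⟨c, hc, hbc⟩ := hcof a b hba
    -- A point `c ≥ b` of `e a` has rank below `λ`, which bounds the ranks of `e a` below `b`. So
    -- this part is too small to be unbounded in `b`.
    refine not_limPt_of_mk_lt (Y := e a ∩ Iio b) ?_
      (hlim.mono fun x hx hxb => ⟨hx, hxb⟩)
    rw [hb]
    exact mk_lt_of_injOn ((hr1 c hc).trans_le hale) (g := r)
      (fun x hx => hr2 hx.1 hc (lt_of_lt_of_le hx.2 hbc)) (hr2.injOn.mono inter_subset_left)

theorem guesses_of_guessesSeq {lam κ θ : Cardinal.{u}} {S : Set Ordinal.{u}} (hlam : lam.IsRegular)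
    (hκ : ℵ₀ < κ) (hκl : κ < lam) (hθ0 : ℵ₀ ≤ θ) (hθ : θ < κ) (hS : Reflects lam κ θ S)
    {F : Ordinal.{u} → ℕ → Ordinal.{u}} (hF : GuessesSeq lam κ F) : Guesses lam κ S := by
  obtain ⟨hSθ, -, hS1⟩ := hS
  obtain ⟨f, hf⟩ := exists_injections lam
  obtain ⟨η, hη⟩ := exists_ladders (one_lt_aleph0.trans_le hθ0).ne'
  obtain ⟨e, he⟩ := exists_cofinal_system lam
  -- The cofinal map must depend on the order type `ε` alone, not on `δ`, so that `ε` can serve as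
  -- one of the `λ` many parameters.
  have hp : ∃ p : Ordinal.{u} → Ordinal.{u} → Ordinal.{u},
      ∀ ε, (∃ q, CofinalMap κ.ord ε q) → CofinalMap κ.ord ε (p ε) := by
    classical
    exact ⟨fun ε => if h : ∃ q, CofinalMap κ.ord ε q then h.choose else id,
      fun ε h => by simp only [dif_pos h]; exact h.choose_spec⟩
  obtain ⟨p, hp⟩ := hp
  have hΛr : (succ lam).IsRegular := isRegular_succ hlam.aleph0_le
  have hΛcof : (succ lam).ord.cof = succ lam := hΛr.cof_ord
  have hΛ0 : ℵ₀ < (succ lam).ord.cof := by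
    rw [hΛcof]; exact hlam.aleph0_le.trans_lt (lt_succ lam)
  have hΛl : IsSuccLimit (succ lam).ord := isSuccLimit_of_aleph0_le_cof hΛ0.le
  have hlamΛ : lam.ord < (succ lam).ord := ord_lt_ord.2 (lt_succ lam)
  have hI : #(Iio lam.ord) < Cardinal.lift.{u + 1} (succ lam).ord.cof := by
    rw [hΛcof]; exact mk_Iio_lt hlamΛ
  rw [isStationaryIn_iff hΛl] at hS1
  have hηS : ∀ x ∈ S, (∀ ζ < θ.ord, η x ζ < x) ∧ ∀ β < x, ∃ ζ < θ.ord, β ≤ η x ζ :=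
    fun x hx => hη x (hSθ hx).2
  -- Four pigeonhole steps over index sets of size `λ < cf λ⁺` make `i`, `ε`, `ζ`, `j` independent
  -- of `δ`.
  obtain ⟨i, hi, hS2⟩ := hS1.exists_of_forall hΛ0 hI
    (Q := fun i δ => ∃ ε < lam.ord, ∃ ζ < lam.ord, ∃ j < lam.ord,
      Splits f η S (fun n => p ε (F j n)) i ζ δ) fun δ hδ _ =>
    exists_splits hlam hκ hκl hθ hf hF hp (fun x hx => (hηS x hx).1) (fun x hx => (hηS x hx).2)
      hδ.1 hδ.2.1 ((isStationaryIn_iff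
        (isSuccLimit_of_aleph0_le_cof (by rw [hδ.2.1]; exact hκ.le)) S).1 hδ.2.2)
  obtain ⟨ε, -, hS3⟩ := hS2.exists_of_forall hΛ0 hI
    (Q := fun ε δ => ∃ ζ < lam.ord, ∃ j < lam.ord,
      Splits f η S (fun n => p ε (F j n)) i ζ δ) fun δ hδ _ => hδ.2
  obtain ⟨ζ, -, hS4⟩ := hS3.exists_of_forall hΛ0 hI
    (Q := fun ζ δ => ∃ j < lam.ord, Splits f η S (fun n => p ε (F j n)) i ζ δ) fun δ hδ _ => hδ.2
  obtain ⟨j, -, hS5⟩ := hS4.exists_of_forall hΛ0 hI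
    (Q := fun j δ => Splits f η S (fun n => p ε (F j n)) i ζ δ) fun δ hδ _ => hδ.2
  let h : Ordinal.{u} → ℕ := fun x => interval (piece f x i) (fun n => p ε (F j n)) (η x ζ)
  let E : Ordinal.{u} → Set Ordinal.{u} := fun x => cl x (walk e (piece f x i) (h x))
  have hmain : ∀ A ⊆ cofSet (succ lam).ord lam, IsUnboundedIn (succ lam).ord A →
      Stat (succ lam).ord {x | (x ∈ S ∧ LimPt (piece f x i) x) ∧ x = sSup (A ∩ nacc (E x))} := by
    intro A hA hAu K hK
    have hAlim : LimPt A (succ lam).ord := ⟨hΛl.ne_bot, hAu⟩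
    obtain ⟨δ, hδ, ⟨hδA, hδK⟩, hδΛ⟩ :=
      hS5 _ ((clb_limPt hΛ0 hAlim).inter hΛ0 (clb_limPt hΛ0 hK.1))
    have hδ0 : ℵ₀ < δ.cof := by rw [hδ.1.1.1.1.2.1]; exact hκ
    obtain ⟨hBlim, ⟨C, hC, hcoh⟩, hst⟩ := hδ.2
    have hBΛ : piece f δ i ⊆ Iio (succ lam).ord := fun x hx => lt_trans hx.1 hδΛ
    have hex : ∀ β ∈ A, β < δ → ∃ n, β ∈ walk e (piece f δ i) n ∧
        ¬ LimPt (walk e (piece f δ i) n) β := by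
      intro β hβ hβδ
      classical
      have hw := exists_mem_walk (fun a ha => (he a ha).1) hBΛ hBlim hβδ
      -- The first stage containing `β` works: a limit there would be a limit of the piece, which
      -- has size `< λ = cf β`, or would have been reached earlier.
      refine ⟨Nat.find hw, Nat.find_spec hw, fun hlim => ?_⟩
      rcases hlim.of_walk (fun a ha => (he a ha).2.2 β (hA hβ).2) hBΛ with h1 | ⟨m, hm, h1⟩
      · refine not_limPt_of_mk_lt ?_ h1
        rw [(hA hβ).2]
        exact mk_piece_lt hf hδΛ hi
      · exact Nat.find_min hw hm h1
    obtain ⟨n, hn⟩ := hδA.exists_nat hδ0 hex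
    -- Colour `n` is stationary in `δ`, so some `x` of that colour lies in `K`, in the coherence
    -- club, and among the limits of the piece and of the points of `A` handled at stage `n`.
    obtain ⟨x, ⟨hxS, hxn⟩, ⟨⟨⟨hxK, hxC⟩, hxB⟩, hxA⟩, hxδ⟩ := hst n _
      ((((hK.of_limPt hδΛ hδK).inter hδ0 hC).inter hδ0 (clb_limPt hδ0 hBlim)).inter hδ0
        (clb_limPt hδ0 hn))
    have hpx := hcoh x hxC hxδ
    have hlimx : LimPt (piece f x i) x := by
      rw [hpx]; exact hxB.mono fun y hy hyx => ⟨hy, hyx⟩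
    refine ⟨x, ⟨⟨hxS, hlimx⟩, ?_⟩, hxK, hxδ.trans hδΛ⟩
    have hwx : walk e (piece f x i) (h x) = walk e (piece f δ i) n ∩ Iio x := by
      change walk e (piece f x i) (interval _ _ _) = _
      rw [hxn, hpx, walk_inter_Iio hxB]
    have hsub : ∀ y ∈ A ∩ nacc (E x), y < x := fun y hy => hy.2.1.1
    have hlim : LimPt (A ∩ nacc (E x)) x := hxA.mono fun y hy hyx => by
      refine ⟨hy.1, mem_nacc_cl (by rw [hwx]; exact ⟨hy.2.1, hyx⟩) hyx ?_ ?_⟩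
      · rintro rfl
        have := (hA hy.1).2
        rw [cof_zero] at this
        exact hlam.ne_zero this.symm
      · rw [hwx]
        exact fun hl => hy.2.2 (hl.mono fun z hz _ => hz.1)
    have hbdd : BddAbove (A ∩ nacc (E x)) := ⟨x, fun y hy => (hsub y hy).le⟩
    refine le_antisymm (le_of_forall_lt fun b hb => ?_) (csSup_le' fun y hy => (hsub y hy).le)
    obtain ⟨y, hy, hby, -⟩ := hlim.2 b hb
    exact hby.trans_le (le_csSup hbdd hy)
  refine ⟨{x ∈ S | LimPt (piece f x i) x}, E, fun x hx => hx.1, ?_, fun x hx => ⟨?_, ?_⟩,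
    fun A hA hAu => (isStationaryIn_iff hΛl _).2 (hmain A hA hAu)⟩
  · rw [isStationaryIn_iff hΛl]
    -- Stationarity of `S'` is guessing applied to the whole of `S^{λ⁺}_λ`, which is unbounded
    -- because it contains every `α + λ`.
    refine (hmain _ subset_rfl fun α hα => ?_).mono fun x hx _ => hx.1
    have hlt : α + lam.ord < (succ lam).ord :=
      (isPrincipal_add_ord hΛr.aleph0_le) hα hlamΛ
    refine ⟨α + lam.ord, ⟨hlt, ?_⟩, ?_, hlt⟩
    · rw [cof_add _ hlam.ord_pos.ne', hlam.cof_ord]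
    · exact lt_add_of_pos_right α hlam.ord_pos
  · exact isClubIn_cl (hx.2.mono fun y hy _ => subset_walk _ hy)
  · have hxΛ : x < (succ lam).ord := (hSθ hx.1).1
    have hωl : ω ≤ lam.ord := by rw [← ord_aleph0]; exact ord_le_ord.2 hlam.aleph0_le
    have h1l : 1 < lam.ord := one_lt_omega0.trans_le hωl
    obtain ⟨ν, hν, hr⟩ := (ranked_of_mk_lt hlam (mk_piece_lt hf hxΛ hi)).walk
      (fun a ha => (he a ha).2.1) hωl (fun y hy => lt_trans hy.1 hxΛ)
      (left_lt_opow h1l one_lt_omega0) (h x)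
    refine (hr.cl (hx.2.mono fun y hy _ => subset_walk _ hy)).otp_le.trans_lt ?_
    rw [Ordinal.lift_lt]
    have h2 : (2 : Ordinal.{u}) < lam.ord ^ ω :=
      ((natCast_lt_omega0 2).trans_le hωl).trans (left_lt_opow h1l one_lt_omega0)
    -- The order type is already below `λ ^ ω`; the factor `κ` is only used through `1 ≤ κ`.
    refine (mul_lt_opow_omega0 h1l h2 hν).trans_le (le_mul_of_one_le_right' ?_)
    exact one_le_iff_ne_zero.2 (ord_pos.2 (aleph0_pos.trans hκ)).ne'

end ClubGuess

theorem theorem2p1 :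
    (∀ (lam κ θ : Cardinal.{u}) (Sstar : Set Ordinal.{u}),
      lam.IsRegular → κ.IsRegular → θ.IsRegular →
      κ < lam → θ < κ → ℵ₁ ≤ θ →
      ClubGuess.Reflects lam κ θ Sstar → ClubGuess.Guesses lam κ Sstar) ∧
    (∀ (lam κ : Cardinal.{u}) (Sstar : Set Ordinal.{u}),
      lam.IsRegular → κ.IsRegular →
      κ < lam → ℵ₀ < κ → (2 : Cardinal.{u}) ^ (ℵ₀ : Cardinal.{u}) ≤ lam →
      ClubGuess.Reflects lam κ ℵ₀ Sstar → ClubGuess.Guesses lam κ Sstar) := by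
  refine ⟨fun lam κ θ S hlam hκ hθ hκl hθκ hθ1 hS => ?_, fun lam κ S hlam hκ hκl hκ0 h2 hS => ?_⟩
  · obtain ⟨F, hF⟩ := ClubGuess.exists_guessesSeq_of_aleph_one_lt hκ (hθ1.trans_lt hθκ) hκl
    exact ClubGuess.guesses_of_guessesSeq hlam (hθ.aleph0_le.trans_lt hθκ) hκl hθ.aleph0_le hθκ hS hF
  · have hκ1 : ℵ₁ ≤ κ := by rw [← succ_aleph0]; exact succ_le_of_lt hκ0
    obtain ⟨F, hF⟩ : ∃ F, ClubGuess.GuessesSeq lam κ F := by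
      -- Only `κ = ℵ₁` needs `2 ^ ℵ₀ ≤ λ`; in the first part `κ > θ ≥ ℵ₁` rules this case out.
      rcases hκ1.eq_or_lt with rfl | hlt
      · exact ClubGuess.exists_guessesSeq_aleph_one h2
      · exact ClubGuess.exists_guessesSeq_of_aleph_one_lt hκ hlt hκl
    exact ClubGuess.guesses_of_guessesSeq hlam hκ0 hκl le_rfl hκ0 hS hF
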